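/- **Setting.** Let $\mathbb K=\mathbb R$ or $\mathbb C$. All functions $g(x,t)$ below are $\mathbb K$-valued on $\mathbb R\times\mathbb R$; $\partial=\partial_x$ and $\partial^{-1}g=\int_{-\infty}^x g\,dx$. Define differential polynomials in $u$ by $b_0=0$, $b_1=1$, $b_{k+1}=Lb_k$ ($k\ge1$), $a_k=-\tfrac12 b_{k,x}$, with $L=-\tfrac14\partial^2-u+\tfrac12\partial^{-1}u_x$, where here $\partial^{-1}$ is the formal primitive without constant term on differential polynomials. Put $A^{(n)}(u,\lambda)\psi=\sum_{i=0}^{n+1}(a_i\psi+b_i\psi_x)\lambda^{n+1-i}$. For $n\ge0$, $\alpha\in\mathbb K$ and $\lambda_1,\dots,\lambda_N\in\mathbb K$, the $n$-th KdV equation with $N$ self-consistent sources is $$u_t=\partial\Big[-2b_{n+2}(u)-2\alpha\sum_{j=1}^N\phi_j^2\Big],\qquad \phi_{j,xx}+(\lambda_j+u)\phi_j=0\quad(1\le j\le N),\tag{1}$$ and its Lax pair, with $\eta=-\tfrac12\alpha$, is $$\psi_{xx}+(\lambda+u)\psi=0,\qquad \psi_t=A^{(n)}(u,\lambda)\psi-\tfrac12\alpha\psi+\alpha\sum_{j=1}^N\phi_j\,\partial^{-1}(\phi_j\psi).\tag{2}$$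 For functions $g_1,\dots,g_k$ let $W_1(g_1,\dots,g_k)=\det F$ with $F_{ij}=\delta_{ij}+\partial^{-1}(g_ig_j)$, and $W_2(g_1,\dots,g_k)=\det G$, where $G_{ij}=\delta_{ij}+\partial^{-1}(g_ig_j)$ for $i<k$ and $G_{kj}=g_j$; $W_1$ of the empty list is $1$. Throughout, $2\partial^2\ln W$ means $2\partial(W_x/W)$. The second binary Darboux transformation with seed $f$ sends $$u\mapsto u+2\partial^2\ln(1+\partial^{-1}f^2),\qquad g\mapsto g-\frac{f}{1+\partial^{-1}f^2}\,\partial^{-1}(fg)$$ for every eigenfunction or source $g$, and adds the new source $f/(1+\partial^{-1}f^2)$. Given $f_1,\dots,f_m$, iterate it: the $i$-th step uses the seed $f_i[i-1]$, where $[i]$ denotes the result after $i$ steps, and it creates the source $\phi_{N+i}$, which the later steps transform like the other sources. **Theorem.** Let $m\ge0$. Let $u,\phi_1,\dots,\phi_N$ be a solution of (1), let $f_1,\dots,f_m$ be solutions of (2) with $\lambda=\lambda_{N+1},\dots,\lambda_{N+m}$ respectively, and let $\psi$ be a solution of (2) with spectral value $\lambda$; all these functions are smooth in $(x,t)$. Assume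 the following, where "locally uniformly in $t$" refers to $x\to-\infty$. * (Decay.) For $g\in\{\phi_1,\dots,\phi_N,f_1,\dots,f_m\}$ and $h\in\{f_1,\dots,f_m,\psi\}$, the products $gh,\ g_xh,\ gh_x,\ g_xh_x$ decay at $x=-\infty$ locally uniformly in $t$; that is, for each $T>0$ they are dominated in absolute value for $x\le0$, $|t|\le T$ by a function of $x$ that is integrable on $(-\infty,0]$ and tends to $0$ at $-\infty$. Also $u$ and each of its $x$-derivatives are bounded as $x\to-\infty$, locally uniformly in $t$ (that is, bounded on $\{x\le 0,\ |t|\le T\}$ for each $T$). * (The transformations are defined.) Either $f_1,\dots,f_m$ are real-valued (always so if $\mathbb K=\mathbb R$), or $W_1(f_1,\dots,f_i)$ has no zero for each $i\le m$. Then $W_1(f_1,\dots,f_m)$ has no zero, and the $m$-times repeated second binary Darboux transformation is given by $$\psi[m]=\frac{W_2(f_1,\dots,f_m,\psi)}{W_1(f_1,\dots,f_m)},\qquad u[m]=u+2\partial^2\ln W_1(f_1,\dots,f_m),$$ $$\phi_j[m]=\frac{W_2(f_1,\dots,f_m,\phi_j)}{W_1(f_1,\dots,f_m)}\quad(1\le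 j\le N),$$ $$\phi_{N+j}[m]=\frac{W_2(f_1,\dots,f_m,f_j)}{W_1(f_1,\dots,f_m)}=\frac{W_2(f_1,\dots,f_{j-1},f_{j+1},\dots,f_m,f_j)}{W_1(f_1,\dots,f_m)}\quad(1\le j\le m).$$ Moreover, these functions are smooth in $x$, the integrals $\partial^{-1}(\phi_j[m]\psi[m])$ converge, and $$\psi[m]_{xx}+(\lambda+u[m])\psi[m]=0,$$ $$\psi[m]_t=A^{(n)}(u[m],\lambda)\psi[m]-\tfrac12\alpha\psi[m]+\alpha\sum_{j=1}^{N+m}\phi_j[m]\,\partial^{-1}(\phi_j[m]\psi[m]),$$ $$u[m]_t=\partial\Big[-2b_{n+2}(u[m])-2\alpha\sum_{j=1}^{N+m}\phi_j[m]^2\Big],\qquad \phi_j[m]_{xx}+(\lambda_j+u[m])\phi_j[m]=0\quad(1\le j\le N+m),$$ so that $u[m],\phi_1[m],\dots,\phi_{N+m}[m]$ solve the $n$-th KdV equation with $N+m$ sources. -/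

import Mathlib

open scoped ContDiff

noncomputable section

namespace KdVSources

/-! Differential polynomials in one function `u`: the variable `X k` stands for the
`k`-th `x`-derivative of `u`. -/

/-- The algebra of differential polynomials in `u`. -/
abbrev DiffPoly (𝕜 : Type*) [RCLike 𝕜] : Type _ := MvPolynomial ℕ 𝕜

/-- The total `x`-derivative on differential polynomials: the derivation that sends the
`k`-th derivative of `u` to the `(k+1)`-st one. -/
def totalD (𝕜 : Type*) [RCLike 𝕜] : Derivation 𝕜 (DiffPoly 𝕜) (DiffPoly 𝕜) :=
  MvPolynomial.mkDerivation 𝕜 (fun k => MvPolynomial.X (k + 1))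

open Classical in
/-- The formal inverse of the total derivative: the primitive without constant term
(and `0` for a differential polynomial that is not a total derivative). -/
def formalInt {𝕜 : Type*} [RCLike 𝕜] (p : DiffPoly 𝕜) : DiffPoly 𝕜 :=
  if h : ∃ q : DiffPoly 𝕜, totalD 𝕜 q = p ∧ MvPolynomial.constantCoeff q = 0 then
    h.choose
  else 0

/-- The recursion operator `L = -(1/4) ∂² - u + (1/2) ∂⁻¹ u_x` on differential polynomials. -/
def recOp {𝕜 : Type*} [RCLike 𝕜] (p : DiffPoly 𝕜) : DiffPoly 𝕜 :=
  (-(1 / 4) : 𝕜) • totalD 𝕜 (totalD 𝕜 p) - MvPolynomial.X 0 * p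
    + (1 / 2 : 𝕜) • formalInt (MvPolynomial.X 1 * p)

/-- `b₀ = 0`, `b₁ = 1`, `b_{k+1} = L b_k` for `k ≥ 1`. -/
def bPoly (𝕜 : Type*) [RCLike 𝕜] : ℕ → DiffPoly 𝕜
  | 0 => 0
  | 1 => 1
  | k + 2 => recOp (bPoly 𝕜 (k + 1))

/-- `a_k = -(1/2) b_{k,x}`. -/
def aPoly (𝕜 : Type*) [RCLike 𝕜] (k : ℕ) : DiffPoly 𝕜 :=
  (-(1 / 2) : 𝕜) • totalD 𝕜 (bPoly 𝕜 k)

/-! Functions `g x t` of the space variable `x` and the time variable `t`. -/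

section

variable {𝕜 : Type*} [RCLike 𝕜]

/-- The partial derivative `g_x`. -/
def dx (g : ℝ → ℝ → 𝕜) : ℝ → ℝ → 𝕜 := fun x t => deriv (fun y => g y t) x

/-- `∂⁻¹ g = ∫_{-∞}^x g dx`. -/
def dinv (g : ℝ → ℝ → 𝕜) : ℝ → ℝ → 𝕜 := fun x t => ∫ y in Set.Iic x, g y t

/-- `∂² ln g = ∂ (g_x / g)`; the second form needs no branch of the logarithm. -/
def dxxLog (g : ℝ → ℝ → 𝕜) : ℝ → ℝ → 𝕜 :=
  fun x t => deriv (logDeriv (fun y => g y t)) x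

/-- The value `p[u]` of a differential polynomial at a function `u`. -/
def evalAt (p : DiffPoly 𝕜) (u : ℝ → ℝ → 𝕜) : ℝ → ℝ → 𝕜 :=
  fun x t => MvPolynomial.eval (fun k => iteratedDeriv k (fun y => u y t) x) p

/-- `A⁽ⁿ⁾(u, lam) ψ = ∑_{i=0}^{n+1} (a_i ψ + b_i ψ_x) lam^{n+1-i}`. -/
def opA (n : ℕ) (u : ℝ → ℝ → 𝕜) (lam : 𝕜) (ψ : ℝ → ℝ → 𝕜) : ℝ → ℝ → 𝕜 :=
  fun x t => ∑ i ∈ Finset.range (n + 2),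
    (evalAt (aPoly 𝕜 i) u x t * ψ x t + evalAt (bPoly 𝕜 i) u x t * dx ψ x t)
      * lam ^ (n + 1 - i)

/-- `Q⁽ⁿ,ᴺ⁾ ψ = A⁽ⁿ⁾(u, lam) ψ + η ψ + α ∑_j φ_j ∂⁻¹(φ_j ψ)`. -/
def opQ (n : ℕ) {N : ℕ} (α η : 𝕜) (u : ℝ → ℝ → 𝕜) (φ : Fin N → ℝ → ℝ → 𝕜) (lam : 𝕜)
    (ψ : ℝ → ℝ → 𝕜) : ℝ → ℝ → 𝕜 :=
  fun x t => opA n u lam ψ x t + η * ψ x t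
    + α * ∑ j, φ j x t * dinv (fun y s => φ j y s * ψ y s) x t

/-- `ψ_xx + (lam + u) ψ = 0`, classically, for `ψ` smooth in `x`. -/
structure SolvesSchrodinger (u : ℝ → ℝ → 𝕜) (lam : 𝕜) (ψ : ℝ → ℝ → 𝕜) : Prop where
  smooth : ∀ t, ContDiff ℝ ∞ (fun x => ψ x t)
  eqn : ∀ x t, dx (dx ψ) x t + (lam + u x t) * ψ x t = 0

/-- `(u, φ_1, …, φ_N)` is a solution of the `n`-th KdV equation with `N` self-consistent
sources: `u_t = ∂[-2 b_{n+2}[u] - 2 α ∑_j φ_j²]`, `φ_{j,xx} + (lam_j + u) φ_j = 0`. -/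
structure SolvesKdV (n : ℕ) {N : ℕ} (α : 𝕜) (lam : Fin N → 𝕜) (u : ℝ → ℝ → 𝕜)
    (φ : Fin N → ℝ → ℝ → 𝕜) : Prop where
  smooth : ∀ t, ContDiff ℝ ∞ (fun x => u x t)
  evolution : ∀ x t, HasDerivAt (fun s => u x s)
    (dx (fun y s => -2 * evalAt (bPoly 𝕜 (n + 2)) u y s - 2 * α * ∑ j, φ j y s ^ 2) x t) t
  source : ∀ j, SolvesSchrodinger u (lam j) (φ j)

/-- `ψ` is a solution of the Lax pair with spectral value `lam`:
`ψ_xx + (lam + u) ψ = 0`, `ψ_t = Q⁽ⁿ,ᴺ⁾ ψ`, with convergent integrals `∂⁻¹(φ_j ψ)`. -/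
structure SolvesLax (n : ℕ) {N : ℕ} (α η : 𝕜) (u : ℝ → ℝ → 𝕜) (φ : Fin N → ℝ → ℝ → 𝕜)
    (lam : 𝕜) (ψ : ℝ → ℝ → 𝕜) : Prop where
  spatial : SolvesSchrodinger u lam ψ
  integrable : ∀ j x t,
    MeasureTheory.IntegrableOn (fun y => φ j y t * ψ y t) (Set.Iic x)
  evolution : ∀ x t, HasDerivAt (fun s => ψ x s) (opQ n α η u φ lam ψ x t) t

/-- Smoothness in `(x, t)` jointly. -/
def JointlySmooth (g : ℝ → ℝ → 𝕜) : Prop := ContDiff ℝ ∞ (Function.uncurry g)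

/-- `g` decays at `x = -∞`: it tends to `0` and is integrable there, locally uniformly in `t`. -/
def DecaysAtBot (g : ℝ → ℝ → 𝕜) : Prop :=
  ∀ T : ℝ, ∃ G : ℝ → ℝ, MeasureTheory.IntegrableOn G (Set.Iic 0) ∧
    Filter.Tendsto G Filter.atBot (nhds 0) ∧
    ∀ x ≤ 0, ∀ t, |t| ≤ T → ‖g x t‖ ≤ G x

/-- The product `g h`, and likewise `g_x h`, `g h_x`, `g_x h_x`, decay at `x = -∞`. -/
def ProductDecays (g h : ℝ → ℝ → 𝕜) : Prop :=
  DecaysAtBot (fun x t => g x t * h x t) ∧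
  DecaysAtBot (fun x t => dx g x t * h x t) ∧
  DecaysAtBot (fun x t => g x t * dx h x t) ∧
  DecaysAtBot (fun x t => dx g x t * dx h x t)

/-- `u` and all its `x`-derivatives stay bounded as `x → -∞`, locally uniformly in `t`. -/
def BoundedAtBot (u : ℝ → ℝ → 𝕜) : Prop :=
  ∀ (k : ℕ) (T : ℝ), ∃ C : ℝ, ∀ x ≤ 0, ∀ t, |t| ≤ T →
    ‖iteratedDeriv k (fun y => u y t) x‖ ≤ C

/-! The second binary Darboux transformation with seed `f`, and its iteration. -/

/-- `1 + ∂⁻¹ f²`. -/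
def tau (f : ℝ → ℝ → 𝕜) : ℝ → ℝ → 𝕜 :=
  fun x t => 1 + dinv (fun y s => f y s ^ 2) x t

/-- `g ↦ g - f / (1 + ∂⁻¹ f²) · ∂⁻¹(f g)`, the action on eigenfunctions and sources. -/
def dtFun (f g : ℝ → ℝ → 𝕜) : ℝ → ℝ → 𝕜 :=
  fun x t => g x t - f x t / tau f x t * dinv (fun y s => f y s * g y s) x t

/-- `u ↦ u + 2 ∂² ln (1 + ∂⁻¹ f²)`, the action on the potential. -/
def dtPot (f u : ℝ → ℝ → 𝕜) : ℝ → ℝ → 𝕜 :=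
  fun x t => u x t + 2 * dxxLog (tau f) x t

/-- `f / (1 + ∂⁻¹ f²)`, the new source created by the transformation. -/
def dtNew (f : ℝ → ℝ → 𝕜) : ℝ → ℝ → 𝕜 := fun x t => f x t / tau f x t

/-- `g[m]`: the result of the `m`-times repeated transformation on the function `g`.
The seed of the `m`-th step is `f_m[m-1]`. -/
def iterFun : (m : ℕ) → (Fin m → ℝ → ℝ → 𝕜) → (ℝ → ℝ → 𝕜) → ℝ → ℝ → 𝕜
  | 0, _, g => g
  | m + 1, f, g =>
      dtFun (iterFun m (fun i => f i.castSucc) (f (Fin.last m)))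
        (iterFun m (fun i => f i.castSucc) g)

/-- `u[m]`: the result of the `m`-times repeated transformation on the potential `u`. -/
def iterPot : (m : ℕ) → (Fin m → ℝ → ℝ → 𝕜) → (ℝ → ℝ → 𝕜) → ℝ → ℝ → 𝕜
  | 0, _, u => u
  | m + 1, f, u =>
      dtPot (iterFun m (fun i => f i.castSucc) (f (Fin.last m)))
        (iterPot m (fun i => f i.castSucc) u)

/-- `φ_1[m], …, φ_{N+m}[m]`: each step transforms the present sources and appends one. -/
def iterSrc {N : ℕ} (φ : Fin N → ℝ → ℝ → 𝕜) :
    (m : ℕ) → (Fin m → ℝ → ℝ → 𝕜) → Fin (N + m) → ℝ → ℝ → 𝕜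
  | 0, _ => φ
  | m + 1, f =>
      Fin.snoc (α := fun _ : Fin (N + m + 1) => ℝ → ℝ → 𝕜)
        (fun j => dtFun (iterFun m (fun i => f i.castSucc) (f (Fin.last m)))
          (iterSrc φ m (fun i => f i.castSucc) j))
        (dtNew (iterFun m (fun i => f i.castSucc) (f (Fin.last m))))

/-! Integral-type Wronskians. -/

/-- `W₁(g_1, …, g_k) = det (δ_ij + ∂⁻¹(g_i g_j))`. -/
def W1 {k : ℕ} (g : Fin k → ℝ → ℝ → 𝕜) : ℝ → ℝ → 𝕜 := fun x t =>
  Matrix.det (Matrix.of fun i j : Fin k =>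
    (if i = j then 1 else 0) + dinv (fun y s => g i y s * g j y s) x t)

/-- `W₂(g_1, …, g_k)`: the matrix of `W₁` with its last row replaced by `(g_1, …, g_k)`. -/
def W2 {k : ℕ} (g : Fin k → ℝ → ℝ → 𝕜) : ℝ → ℝ → 𝕜 := fun x t =>
  Matrix.det (Matrix.of fun i j : Fin k =>
    if (i : ℕ) + 1 = k then g j x t
    else (if i = j then 1 else 0) + dinv (fun y s => g i y s * g j y s) x t)

/-- The list `(f_1, …, f_m, g)`. -/
def appendLast {m : ℕ} (f : Fin m → ℝ → ℝ → 𝕜) (g : ℝ → ℝ → 𝕜) :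
    Fin (m + 1) → ℝ → ℝ → 𝕜 :=
  Fin.snoc (α := fun _ => ℝ → ℝ → 𝕜) f g

/-- The list `(f_1, …, f_{j-1}, f_{j+1}, …, f_m, f_j)`. -/
def moveLast {m : ℕ} (f : Fin m → ℝ → ℝ → 𝕜) (j : Fin m) : Fin m → ℝ → ℝ → 𝕜 :=
  fun i => if i < j then f i else if h : (i : ℕ) + 1 < m then f ⟨i + 1, h⟩ else f j

end

end KdVSources

end

/-!
The theorem follows from its case `m = 1` for arbitrary sources, by induction on `m`. Let `f` be a
seed, `τ = 1 + ∂⁻¹ f²`, `S = ∂⁻¹(f g)` and `g' = g - f S / τ`, `u' = u + 2 (ln τ)_xx`.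

*Spatial equation.* Decay at `-∞` gives `(μ - ν) S = f g_x - f_x g` (`wronskian_eq`), and with this
relation the Schrödinger equation for `g'` is an identity (`eigen_transform`).

*The hierarchy.* The operator `∂³ + 4 u ∂ + 2 u_x = -4 ∂ L` is skew-adjoint, hence the formal
primitive in `L b_k` exists for every `k` (`skewOp_bPoly`). With `c_k = ∑_{i<k} b_i μ^{k-1-i}` the
function `2 f f_x c_k - f² c_{k,x}` has a primitive `h_k` that is a quadratic form in `f`, `f_x`,
and `b_k[u'] = b_k[u] - (h_k / τ)_x`. Indeed the right-hand side satisfies the recursion for `u'`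
(`recursion_transform`), and the constants of integration vanish because everything decays at `-∞`
(`bVal_newPot`).

*Evolution.* For solutions `f`, `g` of the Lax pair, `(f g)_t` is the `x`-derivative of an explicit
bilinear form in `f`, `f_x`, `g`, `g_x` plus `α ∑ ∂⁻¹(φ_j f) ∂⁻¹(φ_j g) - α S`, and differentiation
under the integral sign gives `S_t` (`hasTimeDeriv_pairing`). For `g = f` this is `τ_t`, in which
`h_{n+2}` is the part without sources. Then `u'_t = u_t + 2 (τ_t / τ)_xx` is the transformed KdV
equation (`source_transform`), and the evolution of `g'` is the transformed Lax equation
(`lax_transform`). The new source `f / τ` is the image of `f` itself, which accounts for the term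
`-α S`, that is, for `η = -α/2`.

*Regularity.* The sources satisfy no evolution equation of their own, so functions like `S` are only
once differentiable in `t`. Hence the argument works with the algebra `RegFun` of the functions all
of whose `x`-derivatives are jointly continuous, which the transformation preserves, and takes time
derivatives from the equations.

*Determinants.* The transformed function is `g[m] = g - ∑ c_k f_k`, where `c` solves the linear
system with matrix `δ_ij + ∂⁻¹(f_i f_j)` and right-hand side `∂⁻¹(f_i g)`. Column elimination turns
this into the quotients of `W2` and `W1` and gives `W1(f_1, …, f_{m+1}) = W1(f_1, …, f_m) τ`
(`iterSpec`, `W1_succ`, `W2_appendLast`). In particular `τ` has no zero, since `W1` has none; for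
real seeds the matrix of `W1` is the identity plus a Gram matrix.
-/

noncomputable section

namespace KdVSources

/-! ### Identities in a differential algebra -/

section DifferentialAlgebra

variable {R A : Type*} [CommRing R] [CommRing A] [Algebra R A] (D : Derivation R A A)

theorem derivation_two : D (2 : A) = 0 := by
  simpa using D.map_natCast 2

theorem derivation_four : D (4 : A) = 0 := by
  simpa using D.map_natCast 4

/-- The operator `∂³ + 4 u ∂ + 2 u_x` is skew-adjoint modulo total derivatives. -/
theorem skew_identity (u a b : A) :
    a * (D (D (D b)) + 4 * u * D b + 2 * D u * b) + b * (D (D (D a)) + 4 * u * D a + 2 * D u * a)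
      = D (a * D (D b) + D (D a) * b - D a * D b + 4 * u * (a * b)) := by
  simp only [map_add, map_sub, Derivation.leibniz, smul_eq_mul, derivation_four]
  ring

/-- If `f`, `g` are eigenfunctions with eigenvalues `mu`, `nu`, then `H` is a primitive of
`f A(nu) g + g A(mu) f`, where `A(z) = β(z) ∂ - β(z)_x / 2` and `γ` is the divided difference of
`β` at `mu` and `nu`. The formula for `H` makes sense for `mu = nu` too. -/
theorem deriv_bilinear {u f g mu nu β βm γ H : A} (hmu : D mu = 0)
    (hf : D (D f) = -(mu + u) * f) (hg : D (D g) = -(nu + u) * g)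
    (hβ : βm = β + (mu - nu) * γ) (hnu : D nu = 0)
    (hγ : D (D (D γ)) + 4 * (u + mu) * D γ + 2 * D u * γ = -4 * D β)
    (hH : 2 * H = 2 * γ * D f * D g - D γ * (f * D g + D f * g)
      + f * g * (D (D γ) + 2 * (u + mu) * γ + 2 * β)) :
    2 * D H = 2 * (f * (β * D g) + g * (βm * D f)) - (D β + D βm) * (f * g) := by
  have h1 : 2 * D H = D (2 * H) := by
    simp [derivation_two]
  rw [h1, hH, hβ]
  simp only [map_add, map_sub, Derivation.leibniz, smul_eq_mul, derivation_two, hmu, hnu, hf,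
    hg]
  linear_combination (f * g) * hγ

/-- The recursion is covariant: if `b`, `bs` are consecutive terms for `u`, and `h`, `hs` the
associated primitives, then `b - (h w)_x`, `bs - (hs w)_x` are consecutive terms for the potential
`u + 2 (f² w)_x`. Here `w` stands for `1 / τ`. -/
theorem recursion_transform {u f mu w h c b bs hs : A} (hmu : D mu = 0)
    (hw : D w = -(f * f) * (w * w)) (hf : D (D f) = -(mu + u) * f)
    (hh : D h = 2 * (f * D f) * c - f * f * D c)
    (hc : D (D (D c)) + 4 * (u + mu) * D c + 2 * D u * c = -4 * D b)
    (hb : D (D (D b)) + 4 * u * D b + 2 * D u * b = -4 * D bs)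
    (hhs : D hs = 2 * (f * D f) * (mu * c + b) - f * f * (mu * D c + D b))
    (hs2 : 2 * hs = 2 * mu * h + (2 * c * (D f * D f) - 2 * D c * (f * D f)
      + f * f * (D (D c) + 2 * (u + mu) * c + 2 * b))) :
    D (D (D (b - D (h * w)))) + 4 * (u + 2 * D (f * f * w)) * D (b - D (h * w))
      + 2 * D (u + 2 * D (f * f * w)) * (b - D (h * w)) = -4 * D (bs - D (hs * w)) := by
  have hc' : D (D (D c)) = -4 * D b - 4 * (u + mu) * D c - 2 * D u * c := by
    linear_combination hc
  have e1 : D (h * w) = (2 * (f * D f) * c - f * f * D c) * w - h * (f * f * (w * w)) := by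
    simp only [Derivation.leibniz, smul_eq_mul, hw, hh]; ring
  have e2 : D (hs * w) = (2 * (f * D f) * (mu * c + b) - f * f * (mu * D c + D b)) * w
      - hs * (f * f * (w * w)) := by
    simp only [Derivation.leibniz, smul_eq_mul, hw, hhs]; ring
  have e3 : D (f * f * w) = 2 * (f * D f) * w - f * f * (f * f) * (w * w) := by
    simp only [Derivation.leibniz, smul_eq_mul, hw]; ring
  rw [map_sub D b, map_sub D bs, e1, e2, e3]
  simp only [map_add, map_sub, map_neg, Derivation.leibniz, smul_eq_mul, derivation_two,
    derivation_four, map_zero, hw, hh, hhs, hf, hmu, hc']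
  linear_combination hb - (-4 * f * D f * w ^ 2 + 4 * f ^ 4 * w ^ 3) * hs2

/-- How `A = β ∂ - β_x / 2` acts after the transformation: `K` is the primitive by which `β`
changes, and `(mu - nu) K + G` and `H` are the primitives of the flows of `f²` and of `f g`. -/
theorem transformed_evolution {u f g mu nu w S β γ K G H : A} (hmu : D mu = 0) (hnu : D nu = 0)
    (hw : D w = -(f * f) * (w * w)) (hf : D (D f) = -(mu + u) * f)
    (hS : D S = f * g) (hSW : (mu - nu) * S = f * D g - D f * g)
    (hK : D K = 2 * (f * D f) * γ - f * f * D γ)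
    (hG : 2 * G = 2 * γ * (D f * D f) - 2 * D γ * (f * D f)
      + f * f * (D (D γ) + 2 * (u + mu) * γ + 2 * β))
    (hH : 2 * H = 2 * γ * D f * D g - D γ * (f * D g + D f * g)
      + f * g * (D (D γ) + 2 * (u + mu) * γ + 2 * β)) :
    2 * (β - D (K * w)) * D (g - f * w * S) - D (β - D (K * w)) * (g - f * w * S)
      = 2 * β * D g - D β * g
        - S * w * (2 * (β + (mu - nu) * γ) * D f - D (β + (mu - nu) * γ) * f)
        + 2 * (f * S * (w * w)) * ((mu - nu) * K + G) - 2 * (f * w) * H := by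
  have e1 : D (K * w) = (2 * (f * D f) * γ - f * f * D γ) * w - K * (f * f * (w * w)) := by
    simp only [Derivation.leibniz, smul_eq_mul, hw, hK]; ring
  rw [e1]
  simp only [map_add, map_sub, Derivation.leibniz, smul_eq_mul, derivation_two, hw, hK, hf,
    hmu, hnu, hS]
  linear_combination (w * (2 * γ * D f - D γ * f) - 2 * f * w ^ 2 * K) * hSW
    - (f * S * (w * w)) * hG + (f * w) * hH
end DifferentialAlgebra

/-! ### The recursion operator on differential polynomials -/

section Hierarchy

variable {𝕜 : Type*} [RCLike 𝕜]

theorem formalInt_spec {p : DiffPoly 𝕜} (h : p ∈ LinearMap.range (totalD 𝕜).toLinearMap) :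
    totalD 𝕜 (formalInt p) = p := by
  obtain ⟨q, hq⟩ := h
  have h' : ∃ q : DiffPoly 𝕜, totalD 𝕜 q = p ∧ MvPolynomial.constantCoeff q = 0 := by
    refine ⟨q - MvPolynomial.C (MvPolynomial.constantCoeff q), ?_, by simp⟩
    rw [map_sub]
    have : totalD 𝕜 (MvPolynomial.C (MvPolynomial.constantCoeff q)) = 0 :=
      (totalD 𝕜).map_algebraMap _
    rw [this, sub_zero]
    exact hq
  rw [formalInt, dif_pos h']
  exact h'.choose_spec.1

theorem totalD_X (k : ℕ) : totalD 𝕜 (MvPolynomial.X k) = MvPolynomial.X (k + 1) := by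
  simp [totalD, MvPolynomial.mkDerivation_X]

/-- The operator `∂³ + 4 u ∂ + 2 u_x`, that is `-4 ∂ L`. -/
def skewOp (p : DiffPoly 𝕜) : DiffPoly 𝕜 :=
  totalD 𝕜 (totalD 𝕜 (totalD 𝕜 p)) + 4 * MvPolynomial.X 0 * totalD 𝕜 p
    + 2 * MvPolynomial.X 1 * p

/-- As `skewOp` is skew-adjoint and `b_1 = 1`, moving `skewOp` and `∂` back and forth along
`b_1 · b_k, b_2 · b_{k-1}, …, b_k · b_1` shows that `skewOp b_k` is minus itself up to a total
derivative. -/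
theorem skewOp_mem_range {k : ℕ}
    (ih : ∀ i < k, skewOp (bPoly 𝕜 i) = -4 * totalD 𝕜 (bPoly 𝕜 (i + 1))) :
    skewOp (bPoly 𝕜 k) ∈ LinearMap.range (totalD 𝕜).toLinearMap := by
  set I := LinearMap.range (totalD 𝕜).toLinearMap with hI
  have hD : ∀ p : DiffPoly 𝕜, totalD 𝕜 p ∈ I := fun p => ⟨p, rfl⟩
  have skew : ∀ a b : DiffPoly 𝕜, a * skewOp b + b * skewOp a ∈ I := by
    intro a b
    have := skew_identity (totalD 𝕜) (MvPolynomial.X 0) a b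
    rw [totalD_X] at this
    unfold skewOp
    rw [this]
    exact hD _
  rcases Nat.eq_zero_or_pos k with rfl | hk
  · simp [skewOp, bPoly]
  have chain : ∀ i, i < k →
      bPoly 𝕜 1 * skewOp (bPoly 𝕜 k) - bPoly 𝕜 (i + 1) * skewOp (bPoly 𝕜 (k - i)) ∈ I := by
    intro i
    induction i with
    | zero => intro _; simp
    | succ i hi =>
      intro hik
      have h0 := hi (by omega)
      have h1 := skew (bPoly 𝕜 (i + 1)) (bPoly 𝕜 (k - i))
      rw [ih (i + 1) (by omega)] at h1
      have h2 := hD (bPoly 𝕜 (i + 2) * bPoly 𝕜 (k - i))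
      have h3 := ih (k - (i + 1)) (by omega)
      have e : k - (i + 1) + 1 = k - i := by omega
      rw [e] at h3
      rw [h3]
      have h4 := I.add_mem (I.add_mem h0 h1) (I.smul_mem (4 : 𝕜) h2)
      convert h4 using 1
      simp only [Derivation.leibniz, smul_eq_mul, Algebra.smul_def, map_ofNat]
      ring
  have h1 := chain (k - 1) (by omega)
  have e1 : k - 1 + 1 = k := by omega
  have e2 : k - (k - 1) = 1 := by omega
  rw [e1, e2] at h1
  have h2 := I.smul_mem (1 / 2 : 𝕜) (I.add_mem h1 (skew (bPoly 𝕜 1) (bPoly 𝕜 k)))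
  convert h2 using 1
  have : bPoly 𝕜 1 = 1 := rfl
  rw [this]
  have e : (1 * skewOp (bPoly 𝕜 k) - bPoly 𝕜 k * skewOp 1
      + (1 * skewOp (bPoly 𝕜 k) + bPoly 𝕜 k * skewOp 1)) = (2 : 𝕜) • skewOp (bPoly 𝕜 k) := by
    rw [Algebra.smul_def, map_ofNat]; ring
  rw [e, smul_smul]
  norm_num

/-- The formal primitive in the recursion operator exists at every stage, so that
`b_{k+1,x} = -(1/4) (∂³ + 4 u ∂ + 2 u_x) b_k`. -/
theorem skewOp_bPoly (k : ℕ) :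
    skewOp (bPoly 𝕜 k) = -4 * totalD 𝕜 (bPoly 𝕜 (k + 1)) := by
  induction k using Nat.strong_induction_on with
  | _ k ih =>
    cases k with
    | zero => simp [skewOp, bPoly]
    | succ k =>
      have hr := skewOp_mem_range ih
      set b := bPoly 𝕜 (k + 1) with hb
      have hX : (MvPolynomial.X 1 * b : DiffPoly 𝕜) ∈ LinearMap.range (totalD 𝕜).toLinearMap := by
        obtain ⟨q, hq⟩ := hr
        refine ⟨(-(1 / 2) : 𝕜) • (q - totalD 𝕜 (totalD 𝕜 b)
          - (4 : 𝕜) • (MvPolynomial.X 0 * b)), ?_⟩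
        have hq' : totalD 𝕜 q = skewOp b := hq
        change totalD 𝕜 _ = _
        rw [Derivation.map_smul, map_sub, map_sub, Derivation.map_smul, hq', Derivation.leibniz,
          totalD_X, skewOp]
        have h2 : (2 : DiffPoly 𝕜) = MvPolynomial.C 2 := (map_ofNat MvPolynomial.C 2).symm
        have h4 : (4 : DiffPoly 𝕜) = MvPolynomial.C 4 := (map_ofNat MvPolynomial.C 4).symm
        simp only [smul_eq_mul, MvPolynomial.smul_eq_C_mul]
        rw [← h4]
        have : (MvPolynomial.C (-(1 / 2)) : DiffPoly 𝕜) * 2 = -1 := by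
          rw [h2, ← map_mul]; norm_num
        linear_combination (-(MvPolynomial.X 1 * b : DiffPoly 𝕜)) * this
      change skewOp b = -4 * totalD 𝕜 (recOp b)
      rw [recOp, map_add, map_sub, Derivation.map_smul, Derivation.map_smul, formalInt_spec hX,
        Derivation.leibniz, totalD_X, skewOp]
      have h2 : (2 : DiffPoly 𝕜) = MvPolynomial.C 2 := (map_ofNat MvPolynomial.C 2).symm
      have h4 : (4 : DiffPoly 𝕜) = MvPolynomial.C 4 := (map_ofNat MvPolynomial.C 4).symm
      simp only [smul_eq_mul, MvPolynomial.smul_eq_C_mul]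
      have e1 : (MvPolynomial.C (-(1 / 4)) : DiffPoly 𝕜) * 4 = -1 := by
        rw [h4, ← map_mul]; norm_num
      have e2 : (MvPolynomial.C (1 / 2) : DiffPoly 𝕜) * 2 = 1 := by
        rw [h2, ← map_mul]; norm_num
      linear_combination (totalD 𝕜 (totalD 𝕜 (totalD 𝕜 b))) * e1
        + 2 * (MvPolynomial.X 1 * b : DiffPoly 𝕜) * e2

end Hierarchy

/-! ### The hierarchy under a transformation of the potential -/

section Transform

variable {𝕜 : Type*} [RCLike 𝕜] {A : Type*} [CommRing A] [Algebra 𝕜 A] (D : Derivation 𝕜 A A)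

theorem cancel_two {x y : A} (𝕜 : Type*) [RCLike 𝕜] [Algebra 𝕜 A] (h : 2 * x = 2 * y) : x = y := by
  have h' := congrArg (fun z => (1 / 2 : 𝕜) • z) h
  have e : ∀ z : A, (1 / 2 : 𝕜) • (2 * z) = z := fun z => by
    rw [← map_ofNat (algebraMap 𝕜 A) 2, ← Algebra.smul_def, smul_smul]; norm_num
  simpa only [e] using h'

/-- The value of a differential polynomial at an element of a differential algebra. -/
def diffEval (u : A) : DiffPoly 𝕜 →ₐ[𝕜] A := MvPolynomial.aeval (fun k => D^[k] u)

theorem derivation_diffEval (u : A) (p : DiffPoly 𝕜) :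
    D (diffEval D u p) = diffEval D u (totalD 𝕜 p) := by
  induction p using MvPolynomial.induction_on with
  | C a =>
    have h1 : totalD 𝕜 (MvPolynomial.C a) = 0 := (totalD 𝕜).map_algebraMap _
    rw [h1, map_zero, diffEval, MvPolynomial.aeval_C, Derivation.map_algebraMap]
  | add p q hp hq => simp only [map_add, hp, hq]
  | mul_X p k hp =>
    simp only [map_mul, Derivation.leibniz, smul_eq_mul, map_add, hp, totalD_X]
    simp only [diffEval, MvPolynomial.aeval_X, Function.iterate_succ_apply']

/-- The element `b_k[u]`. -/
def bVal (u : A) (k : ℕ) : A := diffEval D u (bPoly 𝕜 k)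

/-- A sequence killed at index `0` on which `∂³ + 4 u ∂ + 2 u_x` acts as `-4 ∂` after a shift. -/
structure IsRecursive (u : A) (b : ℕ → A) : Prop where
  zero : b 0 = 0
  step : ∀ k, D (D (D (b k))) + 4 * u * D (b k) + 2 * D u * b k = -4 * D (b (k + 1))

theorem isRecursive_bVal (u : A) : IsRecursive D u (bVal D u) where
  zero := by simp [bVal, bPoly]
  step k := by
    have h := congrArg (diffEval D u) (skewOp_bPoly (𝕜 := 𝕜) k)
    simp only [skewOp, map_add, map_mul, map_neg, map_ofNat, ← derivation_diffEval] at h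
    simpa [bVal, diffEval, MvPolynomial.aeval_X] using h

/-- `geomConv b z k = ∑_{i<k} b_i z^{k-1-i}`. -/
def geomConv (b : ℕ → A) (z : A) : ℕ → A
  | 0 => 0
  | k + 1 => z * geomConv b z k + b k

theorem geomConv_eq_sum (b : ℕ → A) (z : A) (k : ℕ) :
    geomConv b z (k + 1) = ∑ i ∈ Finset.range (k + 1), b i * z ^ (k - i) := by
  induction k with
  | zero => simp [geomConv]
  | succ k ih =>
    rw [geomConv, ih, Finset.sum_range_succ _ (k + 1), Finset.mul_sum]
    simp only [Nat.sub_self, pow_zero, mul_one, add_left_inj]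
    refine Finset.sum_congr rfl fun i hi => ?_
    have : k + 1 - i = (k - i) + 1 := by have := Finset.mem_range.1 hi; omega
    rw [this, pow_succ]; ring

/-- `geomConv (geomConv b y) z` is the divided difference of `z ↦ geomConv b z`. -/
theorem geomConv_sub_geomConv (b : ℕ → A) (y z : A) (k : ℕ) :
    geomConv b y k = geomConv b z k + (y - z) * geomConv (geomConv b y) z k := by
  induction k with
  | zero => simp [geomConv]
  | succ k ih =>
    simp only [geomConv]
    linear_combination z * ih

variable {D}

theorem IsRecursive.geomConv {u : A} {b : ℕ → A} (hb : IsRecursive D u b) {z : A} (hz : D z = 0) :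
    IsRecursive D u (geomConv b z) where
  zero := rfl
  step k := by
    induction k with
    | zero => simp [KdVSources.geomConv, hb.zero]
    | succ k ih =>
      simp only [KdVSources.geomConv, map_add, Derivation.leibniz, smul_eq_mul, hz,
        map_zero] at ih ⊢
      linear_combination z * ih + hb.step k

theorem IsRecursive.geomConv_rec {u : A} {b : ℕ → A} (hb : IsRecursive D u b) {z : A} (hz : D z = 0)
    (k : ℕ) : D (D (D (KdVSources.geomConv b z k))) + 4 * (u + z) * D (KdVSources.geomConv b z k)
      + 2 * D u * KdVSources.geomConv b z k = -4 * D (b k) := by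
  have h := (hb.geomConv hz).step k
  simp only [KdVSources.geomConv, map_add, Derivation.leibniz, smul_eq_mul, hz] at h
  linear_combination h

theorem IsRecursive.geomConv_geomConv_rec {u : A} {b : ℕ → A} (hb : IsRecursive D u b) {y z : A}
    (hy : D y = 0) (hz : D z = 0) (k : ℕ) :
    D (D (D (KdVSources.geomConv (KdVSources.geomConv b y) z k)))
      + 4 * (u + y) * D (KdVSources.geomConv (KdVSources.geomConv b y) z k)
      + 2 * D u * KdVSources.geomConv (KdVSources.geomConv b y) z k
      = -4 * D (KdVSources.geomConv b z k) := by
  have h := (hb.geomConv hy).geomConv_rec hz k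
  rw [geomConv_sub_geomConv b y z] at h
  simp only [map_add, map_sub, Derivation.leibniz, smul_eq_mul, hy, hz] at h
  linear_combination h

variable (𝕜)

/-- The bilinear expression in two eigenfunctions `f`, `g` of the potential `u`. -/
def bilin (D : Derivation 𝕜 A A) (u mu f g γ β : A) : A :=
  γ * D f * D g + algebraMap 𝕜 A (1 / 2) * (f * g * D (D γ) - D γ * (f * D g + D f * g))
    + f * g * ((u + mu) * γ + β)

theorem two_mul_bilin (u mu f g γ β : A) :
    2 * bilin 𝕜 D u mu f g γ β = 2 * γ * D f * D g - D γ * (f * D g + D f * g)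
      + f * g * (D (D γ) + 2 * (u + mu) * γ + 2 * β) := by
  have h : (2 : A) * algebraMap 𝕜 A (1 / 2) = 1 := by
    rw [← map_ofNat (algebraMap 𝕜 A) 2, ← map_mul]; norm_num
  unfold bilin
  linear_combination (f * g * D (D γ) - D γ * (f * D g + D f * g)) * h

variable {𝕜}

theorem derivation_bilin {u f g mu nu : A} {b : ℕ → A} (hb : IsRecursive D u b) (hmu : D mu = 0)
    (hnu : D nu = 0) (hf : D (D f) = -(mu + u) * f) (hg : D (D g) = -(nu + u) * g) (k : ℕ) :
    2 * D (bilin 𝕜 D u mu f g (geomConv (geomConv b mu) nu k) (geomConv b nu k))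
      = 2 * (f * (geomConv b nu k * D g) + g * (geomConv b mu k * D f))
        - (D (geomConv b nu k) + D (geomConv b mu k)) * (f * g) :=
  deriv_bilinear D hmu hf hg (geomConv_sub_geomConv b mu nu k) hnu
    (hb.geomConv_geomConv_rec hmu hnu k)
    (two_mul_bilin 𝕜 u mu f g _ _)

variable (D)

/-- The element `h_k`, a primitive of `2 f f_x c_k - f² c_{k,x}` for the convolution `c` of the
`b_i[u]` with the powers of `mu`. -/
def hVal (u mu f : A) (k : ℕ) : A :=
  bilin 𝕜 D u mu f f (geomConv (geomConv (bVal D u) mu) mu k) (geomConv (bVal D u) mu k)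

variable {D}

theorem derivation_hVal {u f mu : A} (hmu : D mu = 0) (hf : D (D f) = -(mu + u) * f) (k : ℕ) :
    D (hVal D u mu f k) = 2 * (f * D f) * geomConv (bVal D u) mu k
      - f * f * D (geomConv (bVal D u) mu k) := by
  refine cancel_two 𝕜 ?_
  rw [hVal, derivation_bilin (isRecursive_bVal D u) hmu hmu hf hf]
  ring

theorem hVal_succ (u f mu : A) (k : ℕ) (hmu : D mu = 0) :
    2 * hVal D u mu f (k + 1) = 2 * mu * hVal D u mu f k
      + (2 * geomConv (bVal D u) mu k * (D f * D f) - 2 * D (geomConv (bVal D u) mu k) * (f * D f)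
        + f * f * (D (D (geomConv (bVal D u) mu k)) + 2 * (u + mu) * geomConv (bVal D u) mu k
          + 2 * bVal D u k)) := by
  have h := two_mul_bilin 𝕜 (D := D) u mu f f (geomConv (geomConv (bVal D u) mu) mu k)
    (geomConv (bVal D u) mu k)
  rw [mul_right_comm, hVal, hVal, mul_assoc 2, mul_comm _ mu, mul_left_comm, h, two_mul_bilin]
  simp only [geomConv, map_add, Derivation.leibniz, smul_eq_mul, hmu, map_zero]
  ring

/-- The effect of the transformation on the hierarchy. The recursion determines `b_{k+1}` up to a
constant, and `I` is any set of elements that contains no nonzero constant. -/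
theorem bVal_transform {u f w mu : A} (hmu : D mu = 0) (hf : D (D f) = -(mu + u) * f)
    (hw : D w = -(f * f) * (w * w)) {I : Set A} (hI : ∀ a ∈ I, D a = 0 → a = 0)
    (hmem : ∀ k, bVal D (u + 2 * D (f * f * w)) k - bVal D u k + D (hVal D u mu f k * w) ∈ I)
    (k : ℕ) :
    bVal D (u + 2 * D (f * f * w)) k = bVal D u k - D (hVal D u mu f k * w) := by
  induction k with
  | zero =>
    have : hVal D u mu f 0 = 0 := by simp [hVal, bilin, geomConv]
    rw [this, (isRecursive_bVal D u).zero, (isRecursive_bVal D _).zero]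
    simp
  | succ k ih =>
    have h1 := recursion_transform D hmu hw hf (derivation_hVal hmu hf k)
      ((isRecursive_bVal D u).geomConv_rec hmu k) ((isRecursive_bVal D u).step k)
      (by rw [derivation_hVal hmu hf]
          simp only [geomConv, map_add, Derivation.leibniz, smul_eq_mul, hmu]; ring)
      (hVal_succ u f mu k hmu)
    have h2 := (isRecursive_bVal D (u + 2 * D (f * f * w))).step k
    rw [ih, h1] at h2
    have h3 : D (bVal D (u + 2 * D (f * f * w)) (k + 1) - bVal D u (k + 1)
        + D (hVal D u mu f (k + 1) * w)) = 0 := by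
      refine cancel_two 𝕜 (cancel_two 𝕜 ?_)
      simp only [map_sub, map_add] at h2 ⊢
      linear_combination h2
    linear_combination hI _ (hmem (k + 1)) h3

/-- The formula for `A⁽ⁿ⁾(u', nu) g'` that `transformed_evolution` gives for the sums
`β = ∑ b_i nu^{k-1-i}`. -/
theorem flow_transform {u f g w S mu nu : A} (hmu : D mu = 0) (hnu : D nu = 0)
    (hf : D (D f) = -(mu + u) * f) (hw : D w = -(f * f) * (w * w)) (hS : D S = f * g)
    (hSW : (mu - nu) * S = f * D g - D f * g)
    (hU : ∀ k, bVal D (u + 2 * D (f * f * w)) k = bVal D u k - D (hVal D u mu f k * w)) (k : ℕ) :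
    2 * geomConv (bVal D (u + 2 * D (f * f * w))) nu k * D (g - f * w * S)
        - D (geomConv (bVal D (u + 2 * D (f * f * w))) nu k) * (g - f * w * S)
      = 2 * geomConv (bVal D u) nu k * D g - D (geomConv (bVal D u) nu k) * g
        - S * w * (2 * geomConv (bVal D u) mu k * D f - D (geomConv (bVal D u) mu k) * f)
        + 2 * (f * S * (w * w)) * hVal D u mu f k
        - 2 * (f * w) *
          bilin 𝕜 D u mu f g (geomConv (geomConv (bVal D u) mu) nu k)
            (geomConv (bVal D u) nu k) := by
  have e : ∀ k, geomConv (bVal D (u + 2 * D (f * f * w))) nu k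
      = geomConv (bVal D u) nu k - D (geomConv (hVal D u mu f) nu k * w) := by
    intro k
    induction k with
    | zero => simp [geomConv]
    | succ k ih =>
      change nu * geomConv _ nu k + bVal D _ k = _
      rw [ih, hU]
      simp only [geomConv, add_mul, mul_assoc, map_add, D.leibniz nu, smul_eq_mul, hnu]
      ring
  have hK : ∀ k, D (geomConv (hVal D u mu f) nu k)
      = 2 * (f * D f) * geomConv (geomConv (bVal D u) mu) nu k
        - f * f * D (geomConv (geomConv (bVal D u) mu) nu k) := by
    intro k
    induction k with
    | zero => simp [geomConv]
    | succ k ih =>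
      simp only [geomConv, map_add, Derivation.leibniz, smul_eq_mul, hnu, ih,
        derivation_hVal hmu hf]
      ring
  have hK2 : ∀ k, 2 * geomConv (hVal D u mu f) nu k
      = 2 * bilin 𝕜 D u mu f f (geomConv (geomConv (geomConv (bVal D u) mu) mu) nu k)
        (geomConv (geomConv (bVal D u) mu) nu k) := by
    intro k
    rw [two_mul_bilin]
    induction k with
    | zero => simp [geomConv]
    | succ k ih =>
      have h := two_mul_bilin 𝕜 (D := D) u mu f f (geomConv (geomConv (bVal D u) mu) mu k)
        (geomConv (bVal D u) mu k)
      simp only [geomConv, map_add, Derivation.leibniz, smul_eq_mul, hnu, map_zero, hVal]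
      linear_combination nu * ih + h
  have hh : hVal D u mu f k = (mu - nu) * geomConv (hVal D u mu f) nu k
      + bilin 𝕜 D u mu f f (geomConv (geomConv (bVal D u) mu) nu k) (geomConv (bVal D u) nu k) := by
    refine cancel_two 𝕜 ?_
    have h1 := hK2 k
    have h2 := two_mul_bilin 𝕜 (D := D) u mu f f (geomConv (geomConv (bVal D u) mu) mu k)
      (geomConv (bVal D u) mu k)
    rw [geomConv_sub_geomConv (bVal D u) mu nu,
      geomConv_sub_geomConv (geomConv (bVal D u) mu) mu nu] at h2
    simp only [map_add, map_sub, Derivation.leibniz, smul_eq_mul, hmu, hnu] at h2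
    rw [mul_add, two_mul_bilin, hVal, geomConv_sub_geomConv (bVal D u) mu nu,
      geomConv_sub_geomConv (geomConv (bVal D u) mu) mu nu]
    rw [two_mul_bilin] at h1
    simp only [map_zero, sub_zero, mul_zero, add_zero] at h2
    linear_combination h2 - (mu - nu) * h1
  rw [e, hh, geomConv_sub_geomConv (bVal D u) mu nu]
  exact transformed_evolution D hmu hnu hw hf hS hSW (hK k)
    (by rw [two_mul_bilin]; ring) (two_mul_bilin 𝕜 u mu f g _ _)

end Transform
open Set Filter Topology MeasureTheory

/-! ### Functions with jointly continuous `x`-derivatives -/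

section RegularFunctions

variable {𝕜 : Type*} [RCLike 𝕜]

/-- Joint continuity together with differentiability in `x`. -/
def XDiff (g : ℝ → ℝ → 𝕜) : Prop :=
  (Continuous fun p : ℝ × ℝ => g p.1 p.2) ∧ ∀ x t, DifferentiableAt ℝ (fun y => g y t) x

/-- The first `k` of the `x`-derivatives of `g` satisfy `XDiff`. -/
def XDiffUpTo : ℕ → (ℝ → ℝ → 𝕜) → Prop
  | 0, g => XDiff g
  | k + 1, g => XDiff g ∧ XDiffUpTo k (dx g)

theorem XDiffUpTo.xDiff {k : ℕ} {g : ℝ → ℝ → 𝕜} (h : XDiffUpTo k g) : XDiff g := by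
  cases k with
  | zero => exact h
  | succ k => exact h.1

theorem XDiffUpTo.of_succ {k : ℕ} {g : ℝ → ℝ → 𝕜} (h : XDiffUpTo (k + 1) g) : XDiffUpTo k g := by
  induction k generalizing g with
  | zero => exact h.1
  | succ k ih => exact ⟨h.1, ih h.2⟩

theorem dx_add {g h : ℝ → ℝ → 𝕜} (hg : XDiff g) (hh : XDiff h) : dx (g + h) = dx g + dx h := by
  funext x t
  exact deriv_add (hg.2 x t) (hh.2 x t)

theorem dx_mul {g h : ℝ → ℝ → 𝕜} (hg : XDiff g) (hh : XDiff h) :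
    dx (g * h) = dx g * h + g * dx h := by
  funext x t
  exact deriv_mul (hg.2 x t) (hh.2 x t)

theorem dx_inv {g : ℝ → ℝ → 𝕜} (hg : XDiff g) (h0 : ∀ x t, g x t ≠ 0) :
    dx (g⁻¹) = -dx g * (g⁻¹ * g⁻¹) := by
  funext x t
  have := ((hg.2 x t).hasDerivAt.inv (h0 x t)).deriv
  change deriv (fun y => g y t)⁻¹ x = _
  rw [this]
  simp only [Pi.mul_apply, Pi.neg_apply, Pi.inv_apply, dx]
  field_simp

theorem XDiffUpTo.add {k : ℕ} {g h : ℝ → ℝ → 𝕜} (hg : XDiffUpTo k g) (hh : XDiffUpTo k h) :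
    XDiffUpTo k (g + h) := by
  induction k generalizing g h with
  | zero => exact ⟨hg.1.add hh.1, fun x t => (hg.2 x t).add (hh.2 x t)⟩
  | succ k ih =>
    refine ⟨⟨hg.1.1.add hh.1.1, fun x t => (hg.1.2 x t).add (hh.1.2 x t)⟩, ?_⟩
    rw [dx_add hg.1 hh.1]
    exact ih hg.2 hh.2

theorem XDiffUpTo.mul {k : ℕ} {g h : ℝ → ℝ → 𝕜} (hg : XDiffUpTo k g) (hh : XDiffUpTo k h) :
    XDiffUpTo k (g * h) := by
  induction k generalizing g h with
  | zero => exact ⟨hg.1.mul hh.1, fun x t => (hg.2 x t).mul (hh.2 x t)⟩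
  | succ k ih =>
    refine ⟨⟨hg.1.1.mul hh.1.1, fun x t => (hg.1.2 x t).mul (hh.1.2 x t)⟩, ?_⟩
    rw [dx_mul hg.1 hh.1]
    exact (ih hg.2 hh.of_succ).add (ih hg.of_succ hh.2)

theorem XDiffUpTo.const (k : ℕ) (c : 𝕜) : XDiffUpTo k (fun _ _ => c) := by
  induction k generalizing c with
  | zero => exact ⟨continuous_const, fun x t => differentiableAt_const _⟩
  | succ k ih =>
    refine ⟨⟨continuous_const, fun x t => differentiableAt_const _⟩, ?_⟩
    have : dx (fun (_ : ℝ) (_ : ℝ) => c) = fun _ _ => 0 := by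
      funext x t; simp [dx]
    rw [this]
    exact ih 0

variable (𝕜) in
/-- The algebra of the functions of `(x, t)` all of whose `x`-derivatives exist and are jointly
continuous. -/
def RegFun : Subalgebra 𝕜 (ℝ → ℝ → 𝕜) where
  carrier := {g | ∀ k, XDiffUpTo k g}
  mul_mem' hg hh k := (hg k).mul (hh k)
  add_mem' hg hh k := (hg k).add (hh k)
  algebraMap_mem' c k := XDiffUpTo.const k c

theorem xDiff_of_mem {g : ℝ → ℝ → 𝕜} (hg : g ∈ RegFun 𝕜) : XDiff g := XDiffUpTo.xDiff (hg 0)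

theorem RegFun.dx_mem {g : ℝ → ℝ → 𝕜} (hg : g ∈ RegFun 𝕜) : dx g ∈ RegFun 𝕜 :=
  fun k => (hg (k + 1)).2

theorem RegFun.of_dx {g : ℝ → ℝ → 𝕜} (h : XDiff g) (hg : dx g ∈ RegFun 𝕜) : g ∈ RegFun 𝕜 := by
  intro k
  cases k with
  | zero => exact h
  | succ k => exact ⟨h, hg k⟩

theorem RegFun.inv_mem {g : ℝ → ℝ → 𝕜} (hg : g ∈ RegFun 𝕜) (h0 : ∀ x t, g x t ≠ 0) :
    g⁻¹ ∈ RegFun 𝕜 := by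
  have h : XDiff g⁻¹ := ⟨(xDiff_of_mem hg).1.inv₀ fun p => h0 _ _,
    fun x t => ((xDiff_of_mem hg).2 x t).inv (h0 x t)⟩
  intro k
  induction k with
  | zero => exact h
  | succ k ih =>
    refine ⟨h, ?_⟩
    rw [dx_inv (xDiff_of_mem hg) h0]
    exact ((RegFun 𝕜).neg_mem (dx_mem hg) k).mul (ih.mul ih)

theorem JointlySmooth.dx {g : ℝ → ℝ → 𝕜} (hg : JointlySmooth g) :
    JointlySmooth (KdVSources.dx g) := by
  have e : Function.uncurry (KdVSources.dx g)
      = fun p : ℝ × ℝ => fderiv ℝ (Function.uncurry g) p ((1 : ℝ), (0 : ℝ)) := by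
    funext ⟨x, t⟩
    have h1 : HasFDerivAt (Function.uncurry g) (fderiv ℝ (Function.uncurry g) (x, t)) (x, t) :=
      (hg.differentiable (by simp) _).hasFDerivAt
    have h2 : HasDerivAt (fun y : ℝ => (y, t)) ((1 : ℝ), (0 : ℝ)) x :=
      (hasDerivAt_id x).prodMk (hasDerivAt_const x t)
    exact (h1.comp_hasDerivAt x h2).deriv
  unfold JointlySmooth
  rw [e]
  exact (hg.fderiv_right (m := ∞) (by simp)).clm_apply contDiff_const

theorem JointlySmooth.xDiff {g : ℝ → ℝ → 𝕜} (hg : JointlySmooth g) : XDiff g :=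
  ⟨hg.continuous, fun x t => DifferentiableAt.comp
    (g := Function.uncurry g) (f := fun y => (y, t)) x (hg.differentiable (by simp) (x, t))
    (differentiableAt_id.prodMk (differentiableAt_const t))⟩

theorem JointlySmooth.mem_regFun {g : ℝ → ℝ → 𝕜} (hg : JointlySmooth g) : g ∈ RegFun 𝕜 := by
  intro k
  induction k generalizing g with
  | zero => exact hg.xDiff
  | succ k ih => exact ⟨hg.xDiff, ih hg.dx⟩

variable (𝕜) in
/-- The `x`-derivative as a derivation of the algebra of regular functions. -/
def derivX : Derivation 𝕜 (RegFun 𝕜) (RegFun 𝕜) :=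
  Derivation.mk'
    { toFun := fun a => ⟨dx a, RegFun.dx_mem a.2⟩
      map_add' := fun a b => Subtype.ext (dx_add (xDiff_of_mem a.2) (xDiff_of_mem b.2))
      map_smul' := fun c a => Subtype.ext (by
        funext x t
        exact deriv_const_mul c ((xDiff_of_mem a.2).2 x t)) }
    (fun a b => Subtype.ext (by
      change dx (a.1 * b.1) = _
      rw [dx_mul (xDiff_of_mem a.2) (xDiff_of_mem b.2)]
      change _ = a.1 * dx b.1 + b.1 * dx a.1
      ring))

theorem coe_derivX (a : RegFun 𝕜) : ((derivX 𝕜 a : RegFun 𝕜) : ℝ → ℝ → 𝕜) = dx a := rfl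

theorem coe_derivX_iterate (a : RegFun 𝕜) (k : ℕ) (x t : ℝ) :
    ((derivX 𝕜)^[k] a : RegFun 𝕜).1 x t = iteratedDeriv k (fun y => a.1 y t) x := by
  induction k generalizing x with
  | zero => simp
  | succ k ih =>
    rw [Function.iterate_succ_apply', iteratedDeriv_succ, coe_derivX, dx]
    congr 1
    funext y
    exact ih y

theorem RegFun.contDiff {g : ℝ → ℝ → 𝕜} (hg : g ∈ RegFun 𝕜) (t : ℝ) :
    ContDiff ℝ ∞ (fun x => g x t) := by
  refine contDiff_of_differentiable_iteratedDeriv fun m _ x => ?_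
  have e : iteratedDeriv m (fun y => g y t)
      = fun y => ((derivX 𝕜)^[m] ⟨g, hg⟩ : RegFun 𝕜).1 y t := by
    funext y
    exact (coe_derivX_iterate ⟨g, hg⟩ m y t).symm
  rw [e]
  exact (xDiff_of_mem ((derivX 𝕜)^[m] ⟨g, hg⟩).2).2 x t

theorem evalAt_eq (p : DiffPoly 𝕜) (u : RegFun 𝕜) :
    evalAt p (u : ℝ → ℝ → 𝕜) = (diffEval (derivX 𝕜) u p).1 := by
  induction p using MvPolynomial.induction_on with
  | C a =>
    funext x t
    simp only [evalAt, MvPolynomial.eval_C, diffEval, MvPolynomial.aeval_C]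
    rfl
  | add p q hp hq =>
    rw [map_add]
    change _ = (diffEval (derivX 𝕜) u p).1 + (diffEval (derivX 𝕜) u q).1
    rw [← hp, ← hq]
    funext x t
    simp [evalAt]
  | mul_X p k hp =>
    rw [map_mul]
    change _ = (diffEval (derivX 𝕜) u p).1 * (diffEval (derivX 𝕜) u _).1
    rw [← hp]
    funext x t
    simp [evalAt, diffEval, coe_derivX_iterate]

end RegularFunctions

/-! ### Decay at `x = -∞` and the primitive `∂⁻¹` -/

section Decay

variable {𝕜 : Type*} [RCLike 𝕜]

theorem exists_bound_of_continuous {g : ℝ → ℝ → 𝕜} (hg : Continuous fun p : ℝ × ℝ => g p.1 p.2)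
    (a b T : ℝ) : ∃ C, ∀ x ∈ Icc a b, ∀ t, |t| ≤ T → ‖g x t‖ ≤ C := by
  have hK : IsCompact (Icc a b ×ˢ Icc (-T) T) := isCompact_Icc.prod isCompact_Icc
  obtain ⟨C, hC⟩ := hK.exists_bound_of_continuousOn hg.continuousOn
  exact ⟨C, fun x hx t ht => hC (x, t) ⟨hx, abs_le.1 ht⟩⟩

/-- `g` tends to `0` at `x = -∞`, locally uniformly in `t`. -/
def VanishesAtBot (g : ℝ → ℝ → 𝕜) : Prop :=
  ∀ T : ℝ, ∃ G : ℝ → ℝ, Tendsto G atBot (𝓝 0) ∧ ∀ x ≤ 0, ∀ t, |t| ≤ T → ‖g x t‖ ≤ G x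

/-- `g` is bounded at `x = -∞`, locally uniformly in `t`. -/
def BoundedNearBot (g : ℝ → ℝ → 𝕜) : Prop :=
  ∀ T : ℝ, ∃ C : ℝ, ∀ x ≤ 0, ∀ t, |t| ≤ T → ‖g x t‖ ≤ C

theorem DecaysAtBot.vanishes {g : ℝ → ℝ → 𝕜} (h : DecaysAtBot g) : VanishesAtBot g := fun T =>
  let ⟨G, _, h2, h3⟩ := h T
  ⟨G, h2, h3⟩

theorem VanishesAtBot.tendsto {g : ℝ → ℝ → 𝕜} (h : VanishesAtBot g) (t : ℝ) :
    Tendsto (fun x => g x t) atBot (𝓝 0) := by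
  obtain ⟨G, h1, h2⟩ := h |t|
  refine squeeze_zero_norm' ?_ h1
  filter_upwards [eventually_le_atBot 0] with x hx using h2 x hx t le_rfl

theorem VanishesAtBot.boundedNearBot {g : ℝ → ℝ → 𝕜} (h : VanishesAtBot g)
    (hg : Continuous fun p : ℝ × ℝ => g p.1 p.2) : BoundedNearBot g := by
  intro T
  obtain ⟨G, h1, h2⟩ := h T
  obtain ⟨X, hX⟩ := eventually_atBot.1 (h1.eventually (gt_mem_nhds (zero_lt_one)))
  obtain ⟨C, hC⟩ := exists_bound_of_continuous hg X 0 T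
  refine ⟨max 1 C, fun x hx t ht => ?_⟩
  rcases le_total x X with h | h
  · exact ((h2 x hx t ht).trans (hX x h).le).trans (le_max_left _ _)
  · exact (hC x ⟨h, hx⟩ t ht).trans (le_max_right _ _)

theorem VanishesAtBot.add {g h : ℝ → ℝ → 𝕜} (hg : VanishesAtBot g) (hh : VanishesAtBot h) :
    VanishesAtBot (g + h) := by
  intro T
  obtain ⟨G, g1, g2⟩ := hg T
  obtain ⟨H, h1, h2⟩ := hh T
  exact ⟨fun x => G x + H x, by simpa using g1.add h1, fun x hx t ht =>
    (norm_add_le _ _).trans (add_le_add (g2 x hx t ht) (h2 x hx t ht))⟩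

theorem BoundedNearBot.mul_vanishes {g h : ℝ → ℝ → 𝕜} (hg : BoundedNearBot g)
    (hh : VanishesAtBot h) : VanishesAtBot (g * h) := by
  intro T
  obtain ⟨C, hC⟩ := hg T
  obtain ⟨H, h1, h2⟩ := hh T
  refine ⟨fun x => C * H x, by simpa using h1.const_mul C, fun x hx t ht => ?_⟩
  simp only [Pi.mul_apply, norm_mul]
  exact mul_le_mul (hC x hx t ht) (h2 x hx t ht) (norm_nonneg _)
    ((norm_nonneg _).trans (hC x hx t ht))

theorem DecaysAtBot.add {g h : ℝ → ℝ → 𝕜} (hg : DecaysAtBot g) (hh : DecaysAtBot h) :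
    DecaysAtBot (g + h) := by
  intro T
  obtain ⟨G, g0, g1, g2⟩ := hg T
  obtain ⟨H, h0, h1, h2⟩ := hh T
  exact ⟨fun x => G x + H x, g0.add h0, by simpa using g1.add h1, fun x hx t ht =>
    (norm_add_le _ _).trans (add_le_add (g2 x hx t ht) (h2 x hx t ht))⟩

theorem BoundedNearBot.mul_decays {g h : ℝ → ℝ → 𝕜} (hg : BoundedNearBot g)
    (hh : DecaysAtBot h) : DecaysAtBot (g * h) := by
  intro T
  obtain ⟨C, hC⟩ := hg T
  obtain ⟨H, h0, h1, h2⟩ := hh T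
  refine ⟨fun x => C * H x, h0.const_mul C, by simpa using h1.const_mul C, fun x hx t ht => ?_⟩
  simp only [Pi.mul_apply, norm_mul]
  exact mul_le_mul (hC x hx t ht) (h2 x hx t ht) (norm_nonneg _)
    ((norm_nonneg _).trans (hC x hx t ht))

theorem decaysAtBot_zero : DecaysAtBot (0 : ℝ → ℝ → 𝕜) := fun _ =>
  ⟨0, integrableOn_zero, tendsto_const_nhds, by simp⟩

theorem BoundedNearBot.add {g h : ℝ → ℝ → 𝕜} (hg : BoundedNearBot g) (hh : BoundedNearBot h) :
    BoundedNearBot (g + h) := by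
  intro T
  obtain ⟨C, hC⟩ := hg T
  obtain ⟨C', hC'⟩ := hh T
  exact ⟨C + C', fun x hx t ht =>
    (norm_add_le _ _).trans (add_le_add (hC x hx t ht) (hC' x hx t ht))⟩

theorem BoundedNearBot.mul {g h : ℝ → ℝ → 𝕜} (hg : BoundedNearBot g) (hh : BoundedNearBot h) :
    BoundedNearBot (g * h) := by
  intro T
  obtain ⟨C, hC⟩ := hg T
  obtain ⟨C', hC'⟩ := hh T
  refine ⟨C * C', fun x hx t ht => ?_⟩
  simp only [Pi.mul_apply, norm_mul]
  exact mul_le_mul (hC x hx t ht) (hC' x hx t ht) (norm_nonneg _)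
    ((norm_nonneg _).trans (hC x hx t ht))

/-- The domination for `x ≤ 0` extends to every half-line `x ≤ X` by compactness. -/
theorem DecaysAtBot.exists_dominating {g : ℝ → ℝ → 𝕜} (h : DecaysAtBot g)
    (hg : Continuous fun p : ℝ × ℝ => g p.1 p.2) (X T : ℝ) :
    ∃ G : ℝ → ℝ, IntegrableOn G (Iic X) ∧ ∀ x ≤ X, ∀ t, |t| ≤ T → ‖g x t‖ ≤ G x := by
  obtain ⟨G, h0, -, h2⟩ := h T
  obtain ⟨C, hC⟩ := exists_bound_of_continuous hg 0 X T
  classical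
  refine ⟨fun x => if x ≤ 0 then G x else C, ?_, fun x hx t ht => ?_⟩
  · have h3 : IntegrableOn (fun x => if x ≤ 0 then G x else C) (Iic 0) :=
      h0.congr_fun (fun x (hx : x ≤ 0) => by simp [hx]) measurableSet_Iic
    have h4 : IntegrableOn (fun x => if x ≤ 0 then G x else C) (Ioc 0 X) := by
      have : IntegrableOn (fun _ : ℝ => C) (Ioc 0 X) := integrableOn_const (by simp)
      exact this.congr_fun (fun x hx => by simp [not_le.2 hx.1]) measurableSet_Ioc
    exact (h3.union h4).mono_set fun x hx => by
      rcases le_or_gt x 0 with h | h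
      · exact Or.inl h
      · exact Or.inr ⟨h, hx⟩
  · dsimp only
    split_ifs with h
    · exact h2 x h t ht
    · exact hC x ⟨(not_le.1 h).le, hx⟩ t ht

theorem DecaysAtBot.integrableOn {g : ℝ → ℝ → 𝕜} (h : DecaysAtBot g)
    (hg : Continuous fun p : ℝ × ℝ => g p.1 p.2) (X t : ℝ) :
    IntegrableOn (fun x => g x t) (Iic X) := by
  obtain ⟨G, h1, h2⟩ := h.exists_dominating hg X |t|
  refine Integrable.mono' h1 (by fun_prop) ?_
  exact (ae_restrict_iff' measurableSet_Iic).2 (ae_of_all _ fun x hx => h2 x hx t le_rfl)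

theorem DecaysAtBot.dinv_eq {g : ℝ → ℝ → 𝕜} (h : DecaysAtBot g)
    (hg : Continuous fun p : ℝ × ℝ => g p.1 p.2) (x t : ℝ) :
    dinv g x t = dinv g 0 t + ∫ y in (0 : ℝ)..x, g y t := by
  have := intervalIntegral.integral_Iic_sub_Iic (h.integrableOn hg 0 t) (h.integrableOn hg x t)
  simp only [dinv]
  rw [← this]
  ring

theorem DecaysAtBot.continuous_dinv {g : ℝ → ℝ → 𝕜} (h : DecaysAtBot g)
    (hg : Continuous fun p : ℝ × ℝ => g p.1 p.2) :
    Continuous fun p : ℝ × ℝ => dinv g p.1 p.2 := by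
  have e : (fun p : ℝ × ℝ => dinv g p.1 p.2)
      = fun p => dinv g 0 p.2 + ∫ y in (0 : ℝ)..p.1, g y p.2 := by
    funext p
    exact h.dinv_eq hg p.1 p.2
  rw [e]
  refine Continuous.add ?_ ?_
  · refine Continuous.comp (g := fun t => dinv g 0 t) ?_ continuous_snd
    refine continuous_iff_continuousAt.2 fun t₀ => ?_
    obtain ⟨G, h1, h2⟩ := h.exists_dominating hg 0 (|t₀| + 1)
    refine continuousAt_of_dominated (bound := G) (Eventually.of_forall fun t => by fun_prop) ?_ h1
      (ae_of_all _ fun x => by fun_prop)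
    have hn : ∀ᶠ t in 𝓝 t₀, |t| < |t₀| + 1 :=
      (continuous_abs.tendsto t₀).eventually (gt_mem_nhds (lt_add_one _))
    filter_upwards [hn] with t ht
    exact (ae_restrict_iff' measurableSet_Iic).2 (ae_of_all _ fun x hx => h2 x hx t ht.le)
  · exact intervalIntegral.continuous_parametric_intervalIntegral_of_continuous
      (f := fun (p : ℝ × ℝ) y => g y p.2) (by fun_prop) continuous_fst

theorem DecaysAtBot.hasDerivAt_dinv {g : ℝ → ℝ → 𝕜} (h : DecaysAtBot g)
    (hg : Continuous fun p : ℝ × ℝ => g p.1 p.2) (x t : ℝ) :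
    HasDerivAt (fun y => dinv g y t) (g x t) x := by
  have e : (fun y => dinv g y t) = fun y => dinv g 0 t + ∫ z in (0 : ℝ)..y, g z t := by
    funext y
    exact h.dinv_eq hg y t
  rw [e]
  have hc : Continuous fun y => g y t := by fun_prop
  exact (hc.integral_hasStrictDerivAt 0 x).hasDerivAt.const_add _

theorem DecaysAtBot.vanishes_dinv {g : ℝ → ℝ → 𝕜} (h : DecaysAtBot g) :
    VanishesAtBot (dinv g) := by
  intro T
  obtain ⟨G, h0, -, h2⟩ := h T
  refine ⟨fun x => ∫ y in Iic x, G y, ?_, fun x hx t ht => ?_⟩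
  · have h3 := intervalIntegral_tendsto_integral_Iic 0 h0 tendsto_id
    have h4 : Tendsto (fun x => (∫ y in Iic 0, G y) - ∫ y in x..0, G y) atBot (𝓝 0) := by
      simpa using h3.const_sub (∫ y in Iic 0, G y)
    refine h4.congr' ?_
    filter_upwards [eventually_le_atBot 0] with x hx
    rw [← intervalIntegral.integral_Iic_sub_Iic (h0.mono_set (Iic_subset_Iic.2 hx)) h0]
    ring
  · refine norm_integral_le_of_norm_le (h0.mono_set (Iic_subset_Iic.2 hx)) ?_
    exact (ae_restrict_iff' measurableSet_Iic).2
      (ae_of_all _ fun y hy => h2 y (le_trans hy hx) t ht)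

theorem DecaysAtBot.dinv_mem {g : ℝ → ℝ → 𝕜} (h : DecaysAtBot g) (hg : g ∈ RegFun 𝕜) :
    dinv g ∈ RegFun 𝕜 := by
  have hd := h.hasDerivAt_dinv (xDiff_of_mem hg).1
  refine RegFun.of_dx ⟨h.continuous_dinv (xDiff_of_mem hg).1,
    fun x t => (hd x t).differentiableAt⟩ ?_
  have : dx (dinv g) = g := by
    funext x t
    exact (hd x t).deriv
  rwa [this]

/-- `b` is the time derivative of `a`. -/
def HasTimeDeriv (a b : ℝ → ℝ → 𝕜) : Prop := ∀ x t, HasDerivAt (fun s => a x s) (b x t) t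

/-- Differentiation in `t` under the integral sign from `-∞`. -/
theorem HasTimeDeriv.dinv {g k : ℝ → ℝ → 𝕜} (h : HasTimeDeriv g k) (hg : DecaysAtBot g)
    (hk : DecaysAtBot k) (cg : Continuous fun p : ℝ × ℝ => g p.1 p.2)
    (ck : Continuous fun p : ℝ × ℝ => k p.1 p.2) :
    HasTimeDeriv (KdVSources.dinv g) (KdVSources.dinv k) := by
  intro x t
  obtain ⟨G, h1, h2⟩ := hk.exists_dominating ck x (|t| + 1)
  have hn : {s : ℝ | |s| < |t| + 1} ∈ 𝓝 t :=
    (continuous_abs.tendsto t).eventually (gt_mem_nhds (lt_add_one _))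
  refine (hasDerivAt_integral_of_dominated_loc_of_deriv_le (F := fun s y => g y s)
    (F' := fun s y => k y s) (bound := G) hn (Eventually.of_forall fun s => by fun_prop)
    (hg.integrableOn cg x t) (by fun_prop) ?_ h1 (ae_of_all _ fun y s _ => h y s)).2
  exact (ae_restrict_iff' measurableSet_Iic).2
    (ae_of_all _ fun y hy s hs => h2 y hy s (le_of_lt hs))

/-- The derivatives in `x` and `t` commute. Nothing is known about second `t`-derivatives, so the
argument differentiates `a(x, s) = a(x, t) + ∫ b` under the integral sign. -/
theorem HasTimeDeriv.dx {a b : ℝ → ℝ → 𝕜} (h : HasTimeDeriv a b) (ha : XDiff a) (hb : XDiff b)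
    (hb' : Continuous fun p : ℝ × ℝ => KdVSources.dx b p.1 p.2) :
    HasTimeDeriv (KdVSources.dx a) (KdVSources.dx b) := by
  intro x t
  have cb := hb.1
  have e : ∀ y s, a y s = a y t + ∫ r in t..s, b y r := by
    intro y s
    rw [intervalIntegral.integral_eq_sub_of_hasDerivAt (fun r _ => h y r)
      (Continuous.intervalIntegrable (by fun_prop) _ _)]
    ring
  have e2 : ∀ s, KdVSources.dx a x s = KdVSources.dx a x t + ∫ r in t..s, KdVSources.dx b x r := by
    intro s
    obtain ⟨C, hC⟩ := exists_bound_of_continuous hb' (x - 1) (x + 1) (max |t| |s|)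
    have h1 := intervalIntegral.hasDerivAt_integral_of_dominated_loc_of_deriv_le (μ := volume)
      (F := fun y r => b y r) (F' := fun y r => KdVSources.dx b y r) (bound := fun _ => C)
      (a := t) (b := s) (x₀ := x) (Icc_mem_nhds (sub_one_lt x) (lt_add_one x))
      (Eventually.of_forall fun y => by fun_prop)
      (Continuous.intervalIntegrable (by fun_prop) _ _) (by fun_prop)
      (ae_of_all _ fun r hr y hy => hC y hy r ?_) (by simp)
      (ae_of_all _ fun r _ y _ => (hb.2 y r).hasDerivAt)
    · have h2 := ((ha.2 x t).hasDerivAt.add h1.2).deriv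
      have e3 : (fun y => a y s) = (fun y => a y t) + fun y => ∫ r in t..s, b y r := by
        funext y
        exact e y s
      rw [KdVSources.dx, e3]
      exact h2
    · have := abs_le_max_abs_abs (le_of_lt (mem_Ioc.1 hr).1) (mem_Ioc.1 hr).2
      refine this.trans ?_
      rcases le_total t s with h | h <;> simp [h, le_total]
  have e3 : (fun s => KdVSources.dx a x s)
      = fun s => KdVSources.dx a x t + ∫ r in t..s, KdVSources.dx b x r := funext e2
  rw [e3]
  have hc : Continuous fun r => KdVSources.dx b x r := by fun_prop
  exact (hc.integral_hasStrictDerivAt t t).hasDerivAt.const_add _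

end Decay

/-! ### Bounded and decaying elements -/

section Filtrations

variable {𝕜 : Type*} [RCLike 𝕜]

variable (𝕜) in
/-- The algebra of the regular functions that are bounded at `x = -∞`, locally uniformly in `t`,
together with all their `x`-derivatives. -/
def BddFun : Subalgebra 𝕜 (RegFun 𝕜) where
  carrier := {a | ∀ k, BoundedNearBot ((derivX 𝕜)^[k] a : RegFun 𝕜).1}
  add_mem' {a b} ha hb k := by
    rw [iterate_map_add]
    exact (ha k).add (hb k)
  mul_mem' {a b} ha hb k := by
    induction k generalizing a b with
    | zero => exact (ha 0).mul (hb 0)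
    | succ k ih =>
      rw [Function.iterate_succ_apply, Derivation.leibniz, iterate_map_add]
      exact (ih ha fun j => hb (j + 1)).add (ih hb fun j => ha (j + 1))
  algebraMap_mem' c k := by
    cases k with
    | zero => exact fun T => ⟨‖c‖, fun x _ t _ => le_rfl⟩
    | succ k =>
      rw [Function.iterate_succ_apply, Derivation.map_algebraMap, iterate_map_zero]
      exact fun T => ⟨0, fun x _ t _ => by simp⟩

variable (𝕜) in
/-- The regular functions that decay at `x = -∞` together with all their `x`-derivatives. -/
def DecFun : Submodule 𝕜 (RegFun 𝕜) where
  carrier := {a | ∀ k, DecaysAtBot ((derivX 𝕜)^[k] a : RegFun 𝕜).1}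
  add_mem' {a b} ha hb k := by
    rw [iterate_map_add]
    exact (ha k).add (hb k)
  zero_mem' k := by
    rw [iterate_map_zero]
    exact decaysAtBot_zero
  smul_mem' c a ha k := by
    have : (derivX 𝕜)^[k] (c • a) = c • (derivX 𝕜)^[k] a := by
      induction k generalizing a with
      | zero => rfl
      | succ k ih =>
        rw [Function.iterate_succ_apply, Derivation.map_smul, ih _ fun j => ha (j + 1)]
        rfl
    rw [this]
    have hc : BoundedNearBot (fun (_ _ : ℝ) => c) := fun T => ⟨‖c‖, fun x _ t _ => le_rfl⟩
    exact hc.mul_decays (ha k)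

theorem derivX_mem_bdd {a : RegFun 𝕜} (ha : a ∈ BddFun 𝕜) : derivX 𝕜 a ∈ BddFun 𝕜 :=
  fun k => ha (k + 1)

theorem derivX_mem_dec {a : RegFun 𝕜} (ha : a ∈ DecFun 𝕜) : derivX 𝕜 a ∈ DecFun 𝕜 :=
  fun k => ha (k + 1)

theorem mul_mem_dec {a b : RegFun 𝕜} (ha : a ∈ BddFun 𝕜) (hb : b ∈ DecFun 𝕜) :
    a * b ∈ DecFun 𝕜 := by
  intro k
  induction k generalizing a b with
  | zero => exact (ha 0).mul_decays (hb 0)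
  | succ k ih =>
    rw [Function.iterate_succ_apply, Derivation.leibniz, iterate_map_add, smul_eq_mul, smul_eq_mul,
      mul_comm b]
    exact (ih ha (derivX_mem_dec hb)).add (ih (derivX_mem_bdd ha) hb)

theorem mem_bdd_of_mem_dec {a : RegFun 𝕜} (ha : a ∈ DecFun 𝕜) : a ∈ BddFun 𝕜 :=
  fun k => (ha k).vanishes.boundedNearBot (xDiff_of_mem ((derivX 𝕜)^[k] a).2).1

theorem ofNat_mem_bdd (k : ℕ) [k.AtLeastTwo] : (OfNat.ofNat k : RegFun 𝕜) ∈ BddFun 𝕜 := by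
  rw [← map_ofNat (algebraMap 𝕜 (RegFun 𝕜)) k]
  exact (BddFun 𝕜).algebraMap_mem _

/-- A function of `t` alone that vanishes at `x = -∞` is zero. -/
theorem eq_zero_of_vanishes {a : RegFun 𝕜} (ha : VanishesAtBot a.1) (h : derivX 𝕜 a = 0) :
    a = 0 := by
  refine Subtype.ext (funext fun x => funext fun t => ?_)
  have hd : ∀ y, deriv (fun z => a.1 z t) y = 0 := fun y =>
    congrFun (congrFun (congrArg Subtype.val h) y) t
  have hc := is_const_of_deriv_eq_zero (fun y => (xDiff_of_mem a.2).2 y t) hd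
  have ht := ha.tendsto t
  have : (fun y => a.1 y t) = fun _ => a.1 x t := funext fun y => hc y x
  rw [this] at ht
  exact tendsto_nhds_unique tendsto_const_nhds ht

/-- `P` is the primitive of `a` that vanishes at `x = -∞`. -/
structure IsPrimitive (P a : RegFun 𝕜) : Prop where
  deriv_eq : derivX 𝕜 P = a
  vanishes : VanishesAtBot P.1

theorem IsPrimitive.unique {P Q a : RegFun 𝕜} (hP : IsPrimitive P a) (hQ : IsPrimitive Q a) :
    P = Q := by
  rw [← sub_eq_zero]
  refine eq_zero_of_vanishes ?_ (by rw [map_sub, hP.deriv_eq, hQ.deriv_eq, sub_self])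
  have hm : BoundedNearBot (fun (_ _ : ℝ) => (-1 : 𝕜)) := fun T => ⟨1, fun x _ t _ => by simp⟩
  have := hP.vanishes.add (hm.mul_vanishes hQ.vanishes)
  convert this using 1
  funext x t
  change P.1 x t - Q.1 x t = P.1 x t + (-1) * Q.1 x t
  ring

theorem isPrimitive_dinv {a : RegFun 𝕜} (h : DecaysAtBot a.1) :
    IsPrimitive ⟨dinv a.1, h.dinv_mem a.2⟩ a where
  deriv_eq := Subtype.ext (funext fun x => funext fun t =>
    (h.hasDerivAt_dinv (xDiff_of_mem a.2).1 x t).deriv)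
  vanishes := h.vanishes_dinv

theorem IsPrimitive.coe_eq {P a : RegFun 𝕜} (hP : IsPrimitive P a) (h : DecaysAtBot a.1) :
    P.1 = dinv a.1 :=
  congrArg Subtype.val (hP.unique (isPrimitive_dinv h))

theorem exists_isPrimitive {a : RegFun 𝕜} (h : a ∈ DecFun 𝕜) : ∃ P, IsPrimitive P a :=
  ⟨_, isPrimitive_dinv (h 0)⟩

theorem IsPrimitive.mem_bdd {P a : RegFun 𝕜} (hP : IsPrimitive P a) (h : a ∈ DecFun 𝕜) :
    P ∈ BddFun 𝕜 := by
  intro k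
  cases k with
  | zero => exact hP.vanishes.boundedNearBot (xDiff_of_mem P.2).1
  | succ k =>
    rw [Function.iterate_succ_apply, hP.deriv_eq]
    exact mem_bdd_of_mem_dec h k

theorem vanishes_of_dec {a : RegFun 𝕜} (h : a ∈ DecFun 𝕜) : VanishesAtBot a.1 := (h 0).vanishes

theorem IsPrimitive.mul_left_vanishes {P a b : RegFun 𝕜} (hP : IsPrimitive P a)
    (hb : b ∈ BddFun 𝕜) : VanishesAtBot (b * P).1 :=
  (hb 0).mul_vanishes hP.vanishes

theorem diffEval_mem_bdd {u : RegFun 𝕜} (hu : u ∈ BddFun 𝕜) (p : DiffPoly 𝕜) :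
    diffEval (derivX 𝕜) u p ∈ BddFun 𝕜 := by
  induction p using MvPolynomial.induction_on with
  | C a =>
    rw [diffEval, MvPolynomial.aeval_C]
    exact (BddFun 𝕜).algebraMap_mem a
  | add p q hp hq =>
    rw [map_add]
    exact (BddFun 𝕜).add_mem hp hq
  | mul_X p k hp =>
    rw [map_mul]
    refine (BddFun 𝕜).mul_mem hp ?_
    rw [diffEval, MvPolynomial.aeval_X]
    intro j
    rw [← Function.iterate_add_apply]
    exact hu (j + k)

theorem diffEval_sub_mem_dec {u v : RegFun 𝕜} (hu : u ∈ BddFun 𝕜) (hv : v - u ∈ DecFun 𝕜)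
    (p : DiffPoly 𝕜) : diffEval (derivX 𝕜) v p - diffEval (derivX 𝕜) u p ∈ DecFun 𝕜 := by
  have hv' : v ∈ BddFun 𝕜 := by
    have := (BddFun 𝕜).add_mem (mem_bdd_of_mem_dec hv) hu
    rwa [sub_add_cancel] at this
  induction p using MvPolynomial.induction_on with
  | C a =>
    simp only [diffEval, MvPolynomial.aeval_C, sub_self]
    exact (DecFun 𝕜).zero_mem
  | add p q hp hq =>
    rw [map_add, map_add, add_sub_add_comm]
    exact (DecFun 𝕜).add_mem hp hq
  | mul_X p k hp =>
    have e : diffEval (derivX 𝕜) v (p * MvPolynomial.X k)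
        - diffEval (derivX 𝕜) u (p * MvPolynomial.X k)
        = diffEval (derivX 𝕜) v p * (derivX 𝕜)^[k] (v - u) + (derivX 𝕜)^[k] u *
          (diffEval (derivX 𝕜) v p - diffEval (derivX 𝕜) u p) := by
      rw [iterate_map_sub, map_mul, map_mul]
      simp only [diffEval, MvPolynomial.aeval_X]
      ring
    rw [e]
    refine (DecFun 𝕜).add_mem (mul_mem_dec (diffEval_mem_bdd hv' p) ?_) (mul_mem_dec ?_ hp)
    · intro j
      rw [← Function.iterate_add_apply]
      exact hv (j + k)
    · intro j
      rw [← Function.iterate_add_apply]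
      exact hu (j + k)

theorem geomConv_mem_bdd {b : ℕ → RegFun 𝕜} (hb : ∀ k, b k ∈ BddFun 𝕜) (z : 𝕜) (k : ℕ) :
    geomConv b (algebraMap 𝕜 _ z) k ∈ BddFun 𝕜 := by
  induction k with
  | zero => exact (BddFun 𝕜).zero_mem
  | succ k ih =>
    exact (BddFun 𝕜).add_mem ((BddFun 𝕜).mul_mem ((BddFun 𝕜).algebraMap_mem z) ih) (hb k)

/-- The four products of `g`, `g_x` with `h`, `h_x` decay with all their `x`-derivatives. -/
structure DecPair (g h : RegFun 𝕜) : Prop where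
  mul : g * h ∈ DecFun 𝕜
  deriv_mul : derivX 𝕜 g * h ∈ DecFun 𝕜
  mul_deriv : g * derivX 𝕜 h ∈ DecFun 𝕜
  deriv_mul_deriv : derivX 𝕜 g * derivX 𝕜 h ∈ DecFun 𝕜

theorem DecPair.symm {g h : RegFun 𝕜} (p : DecPair g h) : DecPair h g where
  mul := by rw [mul_comm]; exact p.mul
  deriv_mul := by rw [mul_comm]; exact p.mul_deriv
  mul_deriv := by rw [mul_comm]; exact p.deriv_mul
  deriv_mul_deriv := by rw [mul_comm]; exact p.deriv_mul_deriv

theorem DecPair.productDecays {g h : RegFun 𝕜} (p : DecPair g h) : ProductDecays g.1 h.1 :=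
  ⟨p.mul 0, p.deriv_mul 0, p.mul_deriv 0, p.deriv_mul_deriv 0⟩

/-- For eigenfunctions the span of the four products over the bounded functions is stable under
`∂`, so the decay of the products passes to all their derivatives. -/
theorem decPair_of_productDecays {u g h : RegFun 𝕜} {mu nu : 𝕜} (hu : u ∈ BddFun 𝕜)
    (hg : derivX 𝕜 (derivX 𝕜 g) = -(algebraMap 𝕜 _ mu + u) * g)
    (hh : derivX 𝕜 (derivX 𝕜 h) = -(algebraMap 𝕜 _ nu + u) * h)
    (p : ProductDecays g.1 h.1) : DecPair g h := by
  have key : ∀ k (a b c d : RegFun 𝕜), a ∈ BddFun 𝕜 → b ∈ BddFun 𝕜 → c ∈ BddFun 𝕜 →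
      d ∈ BddFun 𝕜 → DecaysAtBot ((derivX 𝕜)^[k] (a * (g * h) + b * (derivX 𝕜 g * h)
        + c * (g * derivX 𝕜 h) + d * (derivX 𝕜 g * derivX 𝕜 h)) : RegFun 𝕜).1 := by
    intro k
    induction k with
    | zero =>
      intro a b c d ha hb hc hd
      exact ((((ha 0).mul_decays p.1).add ((hb 0).mul_decays p.2.1)).add
        ((hc 0).mul_decays p.2.2.1)).add ((hd 0).mul_decays p.2.2.2)
    | succ k ih =>
      intro a b c d ha hb hc hd
      have hm : algebraMap 𝕜 _ mu + u ∈ BddFun 𝕜 :=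
        (BddFun 𝕜).add_mem ((BddFun 𝕜).algebraMap_mem mu) hu
      have hn : algebraMap 𝕜 _ nu + u ∈ BddFun 𝕜 :=
        (BddFun 𝕜).add_mem ((BddFun 𝕜).algebraMap_mem nu) hu
      have := ih (derivX 𝕜 a - b * (algebraMap 𝕜 _ mu + u) - c * (algebraMap 𝕜 _ nu + u))
        (a + derivX 𝕜 b - d * (algebraMap 𝕜 _ nu + u))
        (a + derivX 𝕜 c - d * (algebraMap 𝕜 _ mu + u))
        (b + c + derivX 𝕜 d)
        (sub_mem (sub_mem (derivX_mem_bdd ha) (mul_mem hb hm)) (mul_mem hc hn))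
        (sub_mem (add_mem ha (derivX_mem_bdd hb)) (mul_mem hd hn))
        (sub_mem (add_mem ha (derivX_mem_bdd hc)) (mul_mem hd hm))
        (add_mem (add_mem hb hc) (derivX_mem_bdd hd))
      rw [Function.iterate_succ_apply]
      convert this using 4
      simp only [map_add, Derivation.leibniz, smul_eq_mul, hg, hh]
      ring
  have h0 := (BddFun 𝕜).zero_mem
  have h1 := (BddFun 𝕜).one_mem
  exact ⟨fun k => by simpa using key k 1 0 0 0 h1 h0 h0 h0,
    fun k => by simpa using key k 0 1 0 0 h0 h1 h0 h0,
    fun k => by simpa using key k 0 0 1 0 h0 h0 h1 h0,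
    fun k => by simpa using key k 0 0 0 1 h0 h0 h0 h1⟩

theorem bilin_mem_dec {u f g γ β : RegFun 𝕜} {mu : 𝕜} (hu : u ∈ BddFun 𝕜) (p : DecPair f g)
    (hγ : γ ∈ BddFun 𝕜) (hβ : β ∈ BddFun 𝕜) :
    bilin 𝕜 (derivX 𝕜) u (algebraMap 𝕜 _ mu) f g γ β ∈ DecFun 𝕜 := by
  have e : bilin 𝕜 (derivX 𝕜) u (algebraMap 𝕜 _ mu) f g γ β
      = γ * (derivX 𝕜 f * derivX 𝕜 g)
        + (-(algebraMap 𝕜 _ (1 / 2) * derivX 𝕜 γ)) * (f * derivX 𝕜 g)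
        + (-(algebraMap 𝕜 _ (1 / 2) * derivX 𝕜 γ)) * (derivX 𝕜 f * g)
        + (algebraMap 𝕜 _ (1 / 2) * derivX 𝕜 (derivX 𝕜 γ) + ((u + algebraMap 𝕜 _ mu) * γ + β))
          * (f * g) := by
    unfold bilin; ring
  have hhalf := (BddFun 𝕜).algebraMap_mem (1 / 2)
  have h2 := neg_mem (mul_mem hhalf (derivX_mem_bdd hγ))
  rw [e]
  refine add_mem (add_mem (add_mem (mul_mem_dec hγ p.deriv_mul_deriv) (mul_mem_dec h2 p.mul_deriv))
    (mul_mem_dec h2 p.deriv_mul)) (mul_mem_dec ?_ p.mul)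
  exact add_mem (mul_mem hhalf (derivX_mem_bdd (derivX_mem_bdd hγ)))
    (add_mem (mul_mem (add_mem hu ((BddFun 𝕜).algebraMap_mem mu)) hγ) hβ)

theorem HasTimeDeriv.mul {a b c d : RegFun 𝕜} (h : HasTimeDeriv a.1 b.1)
    (h' : HasTimeDeriv c.1 d.1) : HasTimeDeriv (a * c : RegFun 𝕜).1 (b * c + a * d : RegFun 𝕜).1 :=
  fun x t => (h x t).mul (h' x t)

theorem HasTimeDeriv.add {a b c d : RegFun 𝕜} (h : HasTimeDeriv a.1 b.1)
    (h' : HasTimeDeriv c.1 d.1) : HasTimeDeriv (a + c : RegFun 𝕜).1 (b + d : RegFun 𝕜).1 :=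
  fun x t => (h x t).add (h' x t)

theorem HasTimeDeriv.sub {a b c d : RegFun 𝕜} (h : HasTimeDeriv a.1 b.1)
    (h' : HasTimeDeriv c.1 d.1) : HasTimeDeriv (a - c : RegFun 𝕜).1 (b - d : RegFun 𝕜).1 :=
  fun x t => (h x t).sub (h' x t)

theorem HasTimeDeriv.congr {a b b' : RegFun 𝕜} (h : HasTimeDeriv a.1 b.1) (e : b = b') :
    HasTimeDeriv a.1 b'.1 := e ▸ h

theorem HasTimeDeriv.inv {a b c : RegFun 𝕜} (h : HasTimeDeriv a.1 b.1) (hc : c * (1 + a) = 1) :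
    HasTimeDeriv c.1 (-b * (c * c) : RegFun 𝕜).1 := by
  have e : ∀ x t, c.1 x t * (1 + a.1 x t) = 1 := fun x t =>
    congrFun (congrFun (congrArg Subtype.val hc) x) t
  intro x t
  have e1 : (fun s => c.1 x s) = fun s => (1 + a.1 x s)⁻¹ := by
    funext s
    exact eq_inv_of_mul_eq_one_left (e x s)
  have h0 : 1 + a.1 x t ≠ 0 := right_ne_zero_of_mul_eq_one (e x t)
  have h1 := ((h x t).const_add 1).inv h0
  rw [e1]
  refine h1.congr_deriv ?_
  change _ = -b.1 x t * (c.1 x t * c.1 x t)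
  rw [congrFun e1 t]
  field_simp

theorem IsPrimitive.hasTimeDeriv {P a K k : RegFun 𝕜} (hP : IsPrimitive P a) (hK : IsPrimitive K k)
    (ha : a ∈ DecFun 𝕜) (hk : k ∈ DecFun 𝕜) (h : HasTimeDeriv a.1 k.1) :
    HasTimeDeriv P.1 K.1 := by
  rw [hP.coe_eq (ha 0), hK.coe_eq (hk 0)]
  exact h.dinv (ha 0) (hk 0) (xDiff_of_mem a.2).1 (xDiff_of_mem k.2).1

theorem HasTimeDeriv.derivX {a b : RegFun 𝕜} (h : HasTimeDeriv a.1 b.1) :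
    HasTimeDeriv (derivX 𝕜 a).1 (derivX 𝕜 b).1 :=
  h.dx (xDiff_of_mem a.2) (xDiff_of_mem b.2) (xDiff_of_mem (KdVSources.derivX 𝕜 b).2).1

end Filtrations

/-! ### One transformation of regular functions -/

section Identity

variable {A : Type*} [CommRing A]

/-- The evolution of `g' = g - f w S`, with the sums over the sources as `σ₁, …, σ₄`. The terms with
`q a = α / 2` produce the contribution `α (f w) (w S)` of the new source. -/
theorem lax_identity {q a f g w S F H G B B' C dB dB' dC df dg X σ₁ σ₂ σ₃ σ₄ : A}
    (hw : w * (1 + F) = 1) (hq : 2 * q = 1)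
    (h : 2 * B' * X - dB' * (g - f * w * S)
      = 2 * B * dg - dB * g - S * w * (2 * C * df - dC * f) + 2 * (f * S * (w * w)) * H
        - 2 * (f * w) * G) :
    2 * (B * dg - q * dB * g - q * a * g + a * σ₁
        - (((C * df - q * dC * f - q * a * f + a * σ₂) * w
            + f * (-(H - a * F + a * σ₄) * (w * w))) * S + f * w * (G - a * S + a * σ₃)))
      = 2 * (B' * X - q * dB' * (g - f * w * S) - q * a * (g - f * w * S)
        + a * (σ₁ - S * w * σ₂ - f * w * σ₃ + f * w * (w * S) * σ₄ + f * w * (w * S))) := by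
  linear_combination -h + (-(dB * g) + g * dB' + dC * (f * w * S) - f * w * S * dB') * hq
    - 2 * a * (f * w * S) * hw

end Identity

section OneStep

variable {𝕜 : Type*} [RCLike 𝕜]

/-- Evaluation of a regular function at a point. -/
def evalPt (x t : ℝ) : RegFun 𝕜 →ₐ[𝕜] 𝕜 where
  toFun a := a.1 x t
  map_one' := rfl
  map_mul' _ _ := rfl
  map_zero' := rfl
  map_add' _ _ := rfl
  commutes' _ := rfl

theorem ext_evalPt {a : RegFun 𝕜} {b : ℝ → ℝ → 𝕜} (h : ∀ x t, b x t = evalPt x t a) : b = a.1 :=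
  funext fun x => funext fun t => h x t

/-- `A⁽ⁿ⁾(u, nu) g + η g + α ∑ φ_j P_j` with `η = -α/2`, where `P_j` stands for `∂⁻¹(φ_j g)`. -/
def laxOp (n : ℕ) {N : ℕ} (α : 𝕜) (u : RegFun 𝕜) (φ P : Fin N → RegFun 𝕜) (nu : 𝕜)
    (g : RegFun 𝕜) : RegFun 𝕜 :=
  geomConv (bVal (derivX 𝕜) u) (algebraMap 𝕜 _ nu) (n + 2) * derivX 𝕜 g
    - algebraMap 𝕜 _ (1 / 2)
      * derivX 𝕜 (geomConv (bVal (derivX 𝕜) u) (algebraMap 𝕜 _ nu) (n + 2)) * g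
    - algebraMap 𝕜 _ (1 / 2) * algebraMap 𝕜 _ α * g + algebraMap 𝕜 _ α * ∑ j, φ j * P j

theorem two_mul_half : (2 : RegFun 𝕜) * algebraMap 𝕜 _ (1 / 2) = 1 := by
  rw [← map_ofNat (algebraMap 𝕜 (RegFun 𝕜)) 2, ← map_mul]; norm_num

theorem opQ_eq (n : ℕ) {N : ℕ} (α : 𝕜) (u : RegFun 𝕜) (φ P : Fin N → RegFun 𝕜) (nu : 𝕜)
    (g : RegFun 𝕜) (hP : ∀ j, (P j).1 = dinv (φ j * g : RegFun 𝕜).1) :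
    opQ n α (-(1 / 2) * α) u.1 (fun j => (φ j).1) nu g.1 = (laxOp n α u φ P nu g).1 := by
  refine ext_evalPt fun x t => ?_
  have e1 : opA n u.1 nu g.1 x t
      = evalPt x t (geomConv (bVal (derivX 𝕜) u) (algebraMap 𝕜 _ nu) (n + 2) * derivX 𝕜 g
      - algebraMap 𝕜 _ (1 / 2)
        * derivX 𝕜 (geomConv (bVal (derivX 𝕜) u) (algebraMap 𝕜 _ nu) (n + 2)) * g) := by
    rw [opA, geomConv_eq_sum, map_sum, Finset.sum_mul, Finset.mul_sum, Finset.sum_mul,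
      ← Finset.sum_sub_distrib, map_sum]
    refine Finset.sum_congr rfl fun i _ => ?_
    rw [evalAt_eq, evalAt_eq]
    have e2 : derivX 𝕜 (bVal (derivX 𝕜) u i * algebraMap 𝕜 (RegFun 𝕜) nu ^ (n + 1 - i))
        = derivX 𝕜 (bVal (derivX 𝕜) u i) * algebraMap 𝕜 (RegFun 𝕜) (nu ^ (n + 1 - i)) := by
      rw [← map_pow, Derivation.leibniz, Derivation.map_algebraMap, smul_zero, zero_add,
        smul_eq_mul, mul_comm]
    rw [e2, aPoly, map_smul, ← derivation_diffEval, ← map_pow, bVal]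
    simp only [map_sub, map_mul, AlgHom.commutes, Algebra.algebraMap_self, RingHom.id_apply]
    change (evalPt x t (-(1 / 2 : 𝕜) • derivX 𝕜 (diffEval (derivX 𝕜) u (bPoly 𝕜 i)))
      * evalPt x t g + evalPt x t (diffEval (derivX 𝕜) u (bPoly 𝕜 i))
      * evalPt x t (derivX 𝕜 g)) * _ = _
    rw [map_smul, smul_eq_mul]
    ring
  have e3 : ∀ j, dinv (fun y s => (φ j).1 y s * g.1 y s) x t = evalPt x t (P j) := fun j =>
    (congrFun (congrFun (hP j) x) t).symm
  rw [opQ, e1, laxOp, map_add, map_sub _ (_ - _)]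
  simp only [map_mul, map_sum, AlgHom.commutes, Algebra.algebraMap_self, RingHom.id_apply, e3]
  change _ + -(1 / 2) * α * evalPt x t g + α * ∑ j, evalPt x t (φ j) * _ = _
  ring

/-- The time derivative of `S = ∂⁻¹(f g)` for two solutions of the Lax pair. The source terms in the
derivative of `f g` add up to `α ∑ (R_j P_j)_x`, so they too are integrated in closed form. -/
theorem hasTimeDeriv_pairing {n N : ℕ} {α : 𝕜} {u f g S : RegFun 𝕜} {φ R P : Fin N → RegFun 𝕜}
    {mu nu : 𝕜} (hu : u ∈ BddFun 𝕜)
    (hf : derivX 𝕜 (derivX 𝕜 f) = -(algebraMap 𝕜 _ mu + u) * f)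
    (hg : derivX 𝕜 (derivX 𝕜 g) = -(algebraMap 𝕜 _ nu + u) * g)
    (hfg : DecPair f g) (hφf : ∀ j, DecPair (φ j) f) (hφg : ∀ j, DecPair (φ j) g)
    (hR : ∀ j, IsPrimitive (R j) (φ j * f)) (hP : ∀ j, IsPrimitive (P j) (φ j * g))
    (hS : IsPrimitive S (f * g))
    (tf : HasTimeDeriv f.1 (laxOp n α u φ R mu f).1)
    (tg : HasTimeDeriv g.1 (laxOp n α u φ P nu g).1) :
    HasTimeDeriv S.1 (bilin 𝕜 (derivX 𝕜) u (algebraMap 𝕜 _ mu) f g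
      (geomConv (geomConv (bVal (derivX 𝕜) u) (algebraMap 𝕜 _ mu)) (algebraMap 𝕜 _ nu) (n + 2))
      (geomConv (bVal (derivX 𝕜) u) (algebraMap 𝕜 _ nu) (n + 2))
      - algebraMap 𝕜 _ α * S + algebraMap 𝕜 _ α * ∑ j, R j * P j : RegFun 𝕜).1 := by
  set D := derivX 𝕜 with hD
  set am := algebraMap 𝕜 (RegFun 𝕜) with ham
  have hb : ∀ k, bVal D u k ∈ BddFun 𝕜 := fun k => diffEval_mem_bdd hu _
  have hcm := geomConv_mem_bdd hb mu
  have hcn := geomConv_mem_bdd hb nu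
  have hα : am α ∈ BddFun 𝕜 := (BddFun 𝕜).algebraMap_mem α
  have hh : am (1 / 2) ∈ BddFun 𝕜 := (BddFun 𝕜).algebraMap_mem _
  have hRb : ∀ j, R j ∈ BddFun 𝕜 := fun j => (hR j).mem_bdd (hφf j).mul
  have hPb : ∀ j, P j ∈ BddFun 𝕜 := fun j => (hP j).mem_bdd (hφg j).mul
  -- the time derivative of `f g` decays, which permits differentiation under the integral sign
  have hk : laxOp n α u φ R mu f * g + f * laxOp n α u φ P nu g ∈ DecFun 𝕜 := by
    have e : laxOp n α u φ R mu f * g + f * laxOp n α u φ P nu g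
        = geomConv (bVal D u) (am mu) (n + 2) * (D f * g)
          + (-(am (1 / 2) * D (geomConv (bVal D u) (am mu) (n + 2)) + am (1 / 2) * am α
            + am (1 / 2) * D (geomConv (bVal D u) (am nu) (n + 2)) + am (1 / 2) * am α)) * (f * g)
          + geomConv (bVal D u) (am nu) (n + 2) * (f * D g)
          + ∑ j, (am α * R j * (φ j * g) + am α * P j * (φ j * f)) := by
      rw [Finset.sum_add_distrib]
      have e1 : ∑ j, am α * R j * (φ j * g) = am α * (∑ j, φ j * R j) * g := by
        rw [Finset.mul_sum, Finset.sum_mul]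
        exact Finset.sum_congr rfl fun j _ => by ring
      have e2 : ∑ j, am α * P j * (φ j * f) = am α * (∑ j, φ j * P j) * f := by
        rw [Finset.mul_sum, Finset.sum_mul]
        exact Finset.sum_congr rfl fun j _ => by ring
      rw [e1, e2, laxOp, laxOp]
      ring
    rw [e]
    refine add_mem (add_mem (add_mem (mul_mem_dec (hcm _) hfg.deriv_mul) (mul_mem_dec ?_ hfg.mul))
      (mul_mem_dec (hcn _) hfg.mul_deriv)) (sum_mem fun j _ => add_mem
        (mul_mem_dec (mul_mem hα (hRb j)) (hφg j).mul)
        (mul_mem_dec (mul_mem hα (hPb j)) (hφf j).mul))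
    exact neg_mem (add_mem (add_mem (add_mem (mul_mem hh (derivX_mem_bdd (hcm _))) (mul_mem hh hα))
      (mul_mem hh (derivX_mem_bdd (hcn _)))) (mul_mem hh hα))
  refine hS.hasTimeDeriv ⟨?_, ?_⟩ hfg.mul hk (tf.mul tg)
  · refine cancel_two 𝕜 ?_
    have hmu : D (am mu) = 0 := Derivation.map_algebraMap _ _
    have hnu : D (am nu) = 0 := Derivation.map_algebraMap _ _
    have hαD : D (am α) = 0 := Derivation.map_algebraMap _ _
    have h1 := derivation_bilin (isRecursive_bVal D u) hmu hnu hf hg (n + 2)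
    have h2 : ∑ j, D (R j * P j) = (∑ j, φ j * R j) * g + f * ∑ j, φ j * P j := by
      rw [Finset.mul_sum, Finset.sum_mul, ← Finset.sum_add_distrib]
      refine Finset.sum_congr rfl fun j _ => ?_
      rw [Derivation.leibniz, (hR j).deriv_eq, (hP j).deriv_eq, smul_eq_mul, smul_eq_mul]
      ring
    have h3 := two_mul_half (𝕜 := 𝕜)
    rw [map_add, map_sub, D.leibniz (am α), D.leibniz (am α), hαD, hS.deriv_eq, map_sum, h2,
      laxOp, laxOp]
    simp only [smul_eq_mul, mul_zero, add_zero]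
    linear_combination h1 + (D (geomConv (bVal D u) (am mu) (n + 2)) * f * g
      + D (geomConv (bVal D u) (am nu) (n + 2)) * f * g + 2 * am α * (f * g)) * h3
  · have hsum : VanishesAtBot (∑ j, R j * P j : RegFun 𝕜).1 := by
      refine Finset.sum_induction _ (fun a : RegFun 𝕜 => VanishesAtBot a.1)
        (fun a b ha hb => ha.add hb) (decaysAtBot_zero.vanishes) fun j _ => ?_
      exact (hP j).mul_left_vanishes (hRb j)
    have hm : -am α ∈ BddFun 𝕜 := neg_mem hα
    have := ((vanishes_of_dec (bilin_mem_dec (mu := mu) hu hfg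
      (geomConv_mem_bdd hcm nu (n + 2)) (hcn (n + 2)))).add ((hm 0).mul_vanishes hS.vanishes)).add
      ((hα 0).mul_vanishes hsum)
    rw [sub_eq_add_neg _ (am α * S), show -(am α * S) = -am α * S by ring]
    exact this

/-- The data of one transformation: a seed `f` with eigenvalue `mu` for the potential `u`, the
primitive `F` of `f²`, and `w = 1 / (1 + F)`. -/
structure SeedData (u f F w : RegFun 𝕜) (mu : 𝕜) : Prop where
  bdd : u ∈ BddFun 𝕜
  eigen : derivX 𝕜 (derivX 𝕜 f) = -(algebraMap 𝕜 _ mu + u) * f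
  dec : DecPair f f
  prim : IsPrimitive F (f * f)
  inv : w * (1 + F) = 1

/-- The transformed potential. -/
def newPot (u f w : RegFun 𝕜) : RegFun 𝕜 := u + 2 * derivX 𝕜 (f * f * w)

variable {u f F w : RegFun 𝕜} {mu nu : 𝕜}

namespace SeedData

theorem deriv_w (s : SeedData u f F w mu) : derivX 𝕜 w = -(f * f) * (w * w) := by
  have h := congrArg (derivX 𝕜) s.inv
  simp only [Derivation.leibniz, map_add, Derivation.map_one_eq_zero, s.prim.deriv_eq,
    smul_eq_mul] at h
  linear_combination w * h - (derivX 𝕜 w) * s.inv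

/-- `1 / τ` is bounded because `τ → 1`, and its derivatives are polynomials in `1 / τ` with bounded
coefficients. -/
theorem w_mem_bdd (s : SeedData u f F w mu) : w ∈ BddFun 𝕜 := by
  have hff := mem_bdd_of_mem_dec s.dec.mul
  have hwb : BoundedNearBot w.1 := by
    intro T
    obtain ⟨G, h1, h2⟩ := s.prim.vanishes T
    obtain ⟨X, hX⟩ := eventually_atBot.1
      (h1.eventually (gt_mem_nhds (by norm_num : (0 : ℝ) < 1 / 2)))
    obtain ⟨C, hC⟩ := exists_bound_of_continuous (xDiff_of_mem w.2).1 X 0 T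
    refine ⟨max 2 C, fun x hx t ht => ?_⟩
    rcases le_total x X with h | h
    · refine le_trans ?_ (le_max_left _ _)
      have hF : ‖F.1 x t‖ ≤ 1 / 2 := (h2 x hx t ht).trans (hX x h).le
      have e : w.1 x t * (1 + F.1 x t) = 1 := congrFun (congrFun (congrArg Subtype.val s.inv) x) t
      have e1 : ‖w.1 x t‖ ≤ ‖w.1 x t‖ * ‖F.1 x t‖ + 1 := by
        have e2 : w.1 x t = 1 - w.1 x t * F.1 x t := by linear_combination e
        calc ‖w.1 x t‖ = ‖1 - w.1 x t * F.1 x t‖ := by rw [← e2]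
          _ ≤ ‖(1 : 𝕜)‖ + ‖w.1 x t * F.1 x t‖ := norm_sub_le _ _
          _ = _ := by rw [norm_one, norm_mul, add_comm]
      nlinarith [norm_nonneg (w.1 x t)]
    · exact (hC x ⟨h, hx⟩ t ht).trans (le_max_right _ _)
  have key : ∀ k m (a : RegFun 𝕜), a ∈ BddFun 𝕜 →
      BoundedNearBot ((derivX 𝕜)^[k] (a * w ^ m) : RegFun 𝕜).1 := by
    intro k
    induction k with
    | zero =>
      intro m a ha
      induction m with
      | zero => simpa using ha 0
      | succ m ih =>
        rw [pow_succ, ← mul_assoc]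
        exact BoundedNearBot.mul ih hwb
    | succ k ih =>
      intro m a ha
      have e : derivX 𝕜 (a * w ^ m) = derivX 𝕜 a * w ^ m + (-(m * a * (f * f))) * w ^ (m + 1) := by
        rw [Derivation.leibniz, Derivation.leibniz_pow, s.deriv_w]
        cases m with
        | zero => simp [mul_comm]
        | succ m =>
          simp only [smul_eq_mul, nsmul_eq_mul, Nat.add_sub_cancel]
          ring
      rw [Function.iterate_succ_apply, e, iterate_map_add]
      exact (ih _ _ (derivX_mem_bdd ha)).add
        (ih _ _ (neg_mem (mul_mem (mul_mem (natCast_mem (BddFun 𝕜) m) ha) hff)))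
  intro k
  simpa using key k 1 1 (BddFun 𝕜).one_mem

theorem newPot_sub_mem_dec (s : SeedData u f F w mu) : newPot u f w - u ∈ DecFun 𝕜 := by
  rw [newPot, add_sub_cancel_left, mul_comm (f * f)]
  exact mul_mem_dec (ofNat_mem_bdd 2) (derivX_mem_dec (mul_mem_dec s.w_mem_bdd s.dec.mul))

theorem newPot_mem_bdd (s : SeedData u f F w mu) : newPot u f w ∈ BddFun 𝕜 := by
  have := (BddFun 𝕜).add_mem (mem_bdd_of_mem_dec s.newPot_sub_mem_dec) s.bdd
  rwa [sub_add_cancel] at this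

/-- `b_k[u'] = b_k[u] - (h_k / τ)_x`. Both `b_k[u'] - b_k[u]` and `h_k / τ` decay at `x = -∞`, which
fixes the constants of integration. -/
theorem bVal_newPot (s : SeedData u f F w mu) (k : ℕ) :
    bVal (derivX 𝕜) (newPot u f w) k
      = bVal (derivX 𝕜) u k - derivX 𝕜 (hVal (derivX 𝕜) u (algebraMap 𝕜 _ mu) f k * w) := by
  refine bVal_transform (Derivation.map_algebraMap _ _) s.eigen s.deriv_w (I := DecFun 𝕜)
    (fun a ha h => eq_zero_of_vanishes (vanishes_of_dec ha) h) (fun k => ?_) k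
  refine add_mem (diffEval_sub_mem_dec s.bdd s.newPot_sub_mem_dec _) (derivX_mem_dec ?_)
  rw [mul_comm]
  have hb : ∀ k, bVal (derivX 𝕜) u k ∈ BddFun 𝕜 := fun k => diffEval_mem_bdd s.bdd _
  exact mul_mem_dec s.w_mem_bdd (bilin_mem_dec s.bdd s.dec
    (geomConv_mem_bdd (geomConv_mem_bdd hb mu) mu k) (geomConv_mem_bdd hb mu k))

/-- `(mu - nu) ∂⁻¹(f g)` is the Wronskian of `f` and `g`: both sides vanish at `-∞` and have the
same derivative. -/
theorem wronskian_eq (s : SeedData u f F w mu) {g S : RegFun 𝕜}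
    (hg : derivX 𝕜 (derivX 𝕜 g) = -(algebraMap 𝕜 _ nu + u) * g) (hfg : DecPair f g)
    (hS : IsPrimitive S (f * g)) :
    (algebraMap 𝕜 _ mu - algebraMap 𝕜 _ nu) * S = f * derivX 𝕜 g - derivX 𝕜 f * g := by
  refine IsPrimitive.unique (a := (algebraMap 𝕜 _ mu - algebraMap 𝕜 _ nu) * (f * g)) ⟨?_, ?_⟩
    ⟨?_, vanishes_of_dec (sub_mem hfg.mul_deriv hfg.deriv_mul)⟩
  · rw [Derivation.leibniz, hS.deriv_eq, ← map_sub, Derivation.map_algebraMap, smul_zero, add_zero,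
      smul_eq_mul]
  · exact hS.mul_left_vanishes (sub_mem ((BddFun 𝕜).algebraMap_mem mu)
      ((BddFun 𝕜).algebraMap_mem nu))
  · simp only [map_sub, Derivation.leibniz, smul_eq_mul, hg, s.eigen]
    ring

theorem eigen_transform (s : SeedData u f F w mu) {g S : RegFun 𝕜}
    (hg : derivX 𝕜 (derivX 𝕜 g) = -(algebraMap 𝕜 _ nu + u) * g) (hfg : DecPair f g)
    (hS : IsPrimitive S (f * g)) :
    derivX 𝕜 (derivX 𝕜 (g - f * w * S))
      = -(algebraMap 𝕜 _ nu + newPot u f w) * (g - f * w * S) := by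
  have h := s.wronskian_eq hg hfg hS
  simp only [newPot, map_sub, map_add, map_neg, Derivation.leibniz, smul_eq_mul, s.deriv_w,
    s.eigen, hg, hS.deriv_eq]
  linear_combination (f * w) * h

/-- `∂⁻¹(h' g') = ∂⁻¹(h g) - ∂⁻¹(f h) ∂⁻¹(f g) / τ` for the transformed functions. -/
theorem prim_transform (s : SeedData u f F w mu) {g h S R P : RegFun 𝕜}
    (hfh : DecPair f h) (hS : IsPrimitive S (f * g)) (hR : IsPrimitive R (f * h))
    (hP : IsPrimitive P (h * g)) :
    IsPrimitive (P - R * w * S) ((h - f * w * R) * (g - f * w * S)) where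
  deriv_eq := by
    simp only [map_sub, Derivation.leibniz, smul_eq_mul, s.deriv_w, hS.deriv_eq, hR.deriv_eq,
      hP.deriv_eq]
    ring
  vanishes := by
    have h1 : -(R * w) ∈ BddFun 𝕜 := neg_mem (mul_mem (hR.mem_bdd hfh.mul) s.w_mem_bdd)
    have := hP.vanishes.add ((h1 0).mul_vanishes hS.vanishes)
    have e : P - R * w * S = P + -(R * w) * S := by ring
    rw [e]
    exact this

theorem decPair_transform_left (s : SeedData u f F w mu) {g h S : RegFun 𝕜}
    (hgh : DecPair g h) (hfg : DecPair f g) (hfh : DecPair f h) (hS : IsPrimitive S (f * g)) :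
    DecPair (g - f * w * S) h := by
  have hw := s.w_mem_bdd
  have hSb := hS.mem_bdd hfg.mul
  have hff := mem_bdd_of_mem_dec s.dec.mul
  have e : derivX 𝕜 (g - f * w * S) = derivX 𝕜 g + (-(f * f * w)) * g
      + (f * f * (w * w) * S) * f + (-(w * S)) * derivX 𝕜 f := by
    simp only [map_sub, Derivation.leibniz, smul_eq_mul, s.deriv_w, hS.deriv_eq]
    ring
  have e0 : g - f * w * S = g + (-(w * S)) * f := by ring
  have b1 : -(w * S) ∈ BddFun 𝕜 := neg_mem (mul_mem hw hSb)
  have b2 : -(f * f * w) ∈ BddFun 𝕜 := neg_mem (mul_mem hff hw)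
  have b3 : f * f * (w * w) * S ∈ BddFun 𝕜 := mul_mem (mul_mem hff (mul_mem hw hw)) hSb
  have k1 : ∀ z, g * z ∈ DecFun 𝕜 → f * z ∈ DecFun 𝕜 → (g - f * w * S) * z ∈ DecFun 𝕜 := by
    intro z h1 h2
    rw [e0, add_mul, mul_assoc]
    exact add_mem h1 (mul_mem_dec b1 h2)
  have k2 : ∀ z, g * z ∈ DecFun 𝕜 → f * z ∈ DecFun 𝕜 → derivX 𝕜 g * z ∈ DecFun 𝕜 →
      derivX 𝕜 f * z ∈ DecFun 𝕜 → derivX 𝕜 (g - f * w * S) * z ∈ DecFun 𝕜 := by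
    intro z h1 h2 h3 h4
    rw [e, add_mul, add_mul, add_mul, mul_assoc, mul_assoc _ f z, mul_assoc _ (derivX 𝕜 f) z]
    exact add_mem (add_mem (add_mem h3 (mul_mem_dec b2 h1)) (mul_mem_dec b3 h2)) (mul_mem_dec b1 h4)
  exact ⟨k1 _ hgh.mul hfh.mul, k2 _ hgh.mul hfh.mul hgh.deriv_mul hfh.deriv_mul,
    k1 _ hgh.mul_deriv hfh.mul_deriv,
    k2 _ hgh.mul_deriv hfh.mul_deriv hgh.deriv_mul_deriv hfh.deriv_mul_deriv⟩

theorem decPair_transform (s : SeedData u f F w mu) {g h S R : RegFun 𝕜}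
    (hgh : DecPair g h) (hfg : DecPair f g) (hfh : DecPair f h) (hS : IsPrimitive S (f * g))
    (hR : IsPrimitive R (f * h)) : DecPair (g - f * w * S) (h - f * w * R) := by
  have h1 := s.decPair_transform_left hgh hfg hfh hS
  have h2 := s.decPair_transform_left hfg.symm hfg s.dec hS
  exact (s.decPair_transform_left h1.symm hfh h2.symm hR).symm

/-- The time derivative of `F = ∂⁻¹ f²`. -/
theorem hasTimeDeriv_primitive {n N : ℕ} {α : 𝕜} {φ R : Fin N → RegFun 𝕜} (s : SeedData u f F w mu)
    (hφf : ∀ j, DecPair (φ j) f) (hR : ∀ j, IsPrimitive (R j) (φ j * f))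
    (tf : HasTimeDeriv f.1 (laxOp n α u φ R mu f).1) :
    HasTimeDeriv F.1 (hVal (derivX 𝕜) u (algebraMap 𝕜 _ mu) f (n + 2)
      - algebraMap 𝕜 _ α * F + algebraMap 𝕜 _ α * ∑ j, R j * R j : RegFun 𝕜).1 :=
  hasTimeDeriv_pairing s.bdd s.eigen s.eigen s.dec hφf hφf hR hR s.prim tf tf

/-- A transformed eigenfunction solves the transformed evolution equation of the Lax pair. -/
theorem lax_transform {n N : ℕ} {α : 𝕜} {φ R P : Fin N → RegFun 𝕜} (s : SeedData u f F w mu)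
    (hφf : ∀ j, DecPair (φ j) f) (hR : ∀ j, IsPrimitive (R j) (φ j * f))
    (tf : HasTimeDeriv f.1 (laxOp n α u φ R mu f).1) {g S : RegFun 𝕜}
    (hg : derivX 𝕜 (derivX 𝕜 g) = -(algebraMap 𝕜 _ nu + u) * g) (hfg : DecPair f g)
    (hφg : ∀ j, DecPair (φ j) g) (hP : ∀ j, IsPrimitive (P j) (φ j * g))
    (hS : IsPrimitive S (f * g)) (tg : HasTimeDeriv g.1 (laxOp n α u φ P nu g).1) :
    HasTimeDeriv (g - f * w * S : RegFun 𝕜).1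
      (laxOp n α (newPot u f w)
        (Fin.snoc (α := fun _ => RegFun 𝕜) (fun j => φ j - f * w * R j) (f * w))
        (Fin.snoc (α := fun _ => RegFun 𝕜) (fun j => P j - R j * w * S) (w * S)) nu
        (g - f * w * S)).1 := by
  have tF := s.hasTimeDeriv_primitive hφf hR tf
  have tw := tF.inv s.inv
  have tS := hasTimeDeriv_pairing s.bdd s.eigen hg hfg hφf hφg hR hP hS tf tg
  have t := tg.sub ((tf.mul tw).mul tS)
  refine t.congr (cancel_two 𝕜 ?_)
  have hfl := flow_transform (Derivation.map_algebraMap _ mu) (Derivation.map_algebraMap _ nu)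
    s.eigen s.deriv_w hS.deriv_eq (s.wronskian_eq hg hfg hS) s.bVal_newPot (n + 2)
  have hsum : ∑ j, (φ j - f * w * R j) * (P j - R j * w * S)
      = ∑ j, φ j * P j - S * w * ∑ j, φ j * R j - f * w * ∑ j, R j * P j
        + f * w * (w * S) * ∑ j, R j * R j := by
    simp only [Finset.mul_sum, ← Finset.sum_sub_distrib, ← Finset.sum_add_distrib]
    exact Finset.sum_congr rfl fun j _ => by ring
  rw [laxOp, laxOp, laxOp, Fin.sum_univ_castSucc]
  simp only [Fin.snoc_castSucc, Fin.snoc_last]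
  rw [hsum]
  rw [← newPot] at hfl
  exact lax_identity s.inv two_mul_half hfl

/-- The transformed potential solves the equation with one more source:
`u'_t = u_t + 2 (τ_t / τ)_xx`, and `τ_t = h_{n+2} - α F + α ∑ R_j²` matches
`b_{n+2}[u'] = b_{n+2}[u] - (h_{n+2} / τ)_x`. -/
theorem source_transform {n N : ℕ} {α : 𝕜} {φ R : Fin N → RegFun 𝕜} (s : SeedData u f F w mu)
    (hφf : ∀ j, DecPair (φ j) f) (hR : ∀ j, IsPrimitive (R j) (φ j * f))
    (tf : HasTimeDeriv f.1 (laxOp n α u φ R mu f).1)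
    (tu : HasTimeDeriv u.1 (derivX 𝕜 (-2 * bVal (derivX 𝕜) u (n + 2)
      - 2 * algebraMap 𝕜 _ α * ∑ j, φ j ^ 2)).1) :
    HasTimeDeriv (newPot u f w).1 (derivX 𝕜 (-2 * bVal (derivX 𝕜) (newPot u f w) (n + 2)
      - 2 * algebraMap 𝕜 _ α * ∑ j, (Fin.snoc (α := fun _ => RegFun 𝕜)
        (fun j => φ j - f * w * R j) (f * w) : Fin (N + 1) → RegFun 𝕜) j ^ 2)).1 := by
  set D := derivX 𝕜 with hD
  set am := algebraMap 𝕜 (RegFun 𝕜)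
  have tF := s.hasTimeDeriv_primitive hφf hR tf
  have tX := ((tf.mul tf).mul (tF.inv s.inv))
  set H := hVal D u (am mu) f (n + 2) with hH
  -- the time derivative of `F` is the primitive of that of `f²`
  have hαD : D (am α) = 0 := Derivation.map_algebraMap _ _
  have h3 := two_mul_half (𝕜 := 𝕜)
  have hdF : D (H - am α * F + am α * ∑ j, R j * R j) = 2 * f * laxOp n α u φ R mu f := by
    have h1 := derivation_hVal (D := D) (u := u) (mu := am mu)
      (Derivation.map_algebraMap _ _) s.eigen (n + 2)
    have h2 : ∑ j, D (R j * R j) = 2 * f * ∑ j, φ j * R j := by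
      rw [Finset.mul_sum]
      refine Finset.sum_congr rfl fun j _ => ?_
      rw [Derivation.leibniz, (hR j).deriv_eq, smul_eq_mul]
      ring
    rw [map_add, map_sub, h1, D.leibniz (am α), D.leibniz (am α), hαD, s.prim.deriv_eq, map_sum, h2,
      laxOp]
    simp only [smul_eq_mul, mul_zero, add_zero]
    linear_combination (f * f * D (geomConv (bVal D u) (am mu) (n + 2)) + am α * (f * f)) * h3
  have tX' : HasTimeDeriv (f * f * w : RegFun 𝕜).1
      (D ((H - am α * F + am α * ∑ j, R j * R j) * w)).1 := by
    refine tX.congr ?_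
    rw [D.leibniz, hdF, s.deriv_w]
    simp only [smul_eq_mul]
    ring
  have t2 : HasTimeDeriv (2 : RegFun 𝕜).1 (0 : RegFun 𝕜).1 := fun x t => hasDerivAt_const _ _
  have t := tu.add (t2.mul tX'.derivX)
  refine t.congr ?_
  have h2D : ∀ z, 2 * D z = D (2 * z) := fun z => by
    rw [D.leibniz, derivation_two, smul_zero, add_zero, smul_eq_mul]
  have hbn : bVal D (newPot u f w) (n + 2) = bVal D u (n + 2) - D (H * w) := s.bVal_newPot _
  rw [zero_mul, zero_add, h2D, ← map_add, hbn, Fin.sum_univ_castSucc]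
  congr 1
  simp only [Fin.snoc_castSucc, Fin.snoc_last]
  have hsum : ∑ j, (φ j - f * w * R j) ^ 2 = ∑ j, φ j ^ 2 - 2 * f * w * ∑ j, φ j * R j
      + f * f * (w * w) * ∑ j, R j * R j := by
    simp only [Finset.mul_sum, ← Finset.sum_sub_distrib, ← Finset.sum_add_distrib]
    exact Finset.sum_congr rfl fun j _ => by ring
  have hR2 : D (∑ j, R j * R j) = 2 * f * ∑ j, φ j * R j := by
    rw [map_sum, Finset.mul_sum]
    refine Finset.sum_congr rfl fun j _ => ?_
    rw [Derivation.leibniz, (hR j).deriv_eq, smul_eq_mul]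
    ring
  have hdw : D w = -(f * f) * (w * w) := s.deriv_w
  have hDF : D F = f * f := s.prim.deriv_eq
  rw [hsum]
  simp only [map_add, map_sub, add_mul, sub_mul, Derivation.leibniz, smul_eq_mul, hαD, hR2,
    hDF, hdw]
  linear_combination (2 * am α * (f * f * w)) * s.inv

end SeedData
end OneStep

/-! ### One transformation of arbitrary solutions -/

section StepOnFunctions

variable {𝕜 : Type*} [RCLike 𝕜]

theorem solvesSchrodinger_iff {u g : RegFun 𝕜} {nu : 𝕜} :
    SolvesSchrodinger u.1 nu g.1
      ↔ derivX 𝕜 (derivX 𝕜 g) = -(algebraMap 𝕜 _ nu + u) * g := by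
  constructor
  · intro h
    refine Subtype.ext (funext fun x => funext fun t => ?_)
    change dx (dx g.1) x t = -(nu + u.1 x t) * g.1 x t
    linear_combination h.eqn x t
  · intro h
    refine ⟨RegFun.contDiff g.2, fun x t => ?_⟩
    have h' : dx (dx g.1) x t = -(nu + u.1 x t) * g.1 x t :=
      congrFun (congrFun (congrArg Subtype.val h) x) t
    linear_combination h'

theorem boundedAtBot_iff {u : RegFun 𝕜} : BoundedAtBot u.1 ↔ u ∈ BddFun 𝕜 := by
  have e : ∀ k x t, ((derivX 𝕜)^[k] u : RegFun 𝕜).1 x t = iteratedDeriv k (fun y => u.1 y t) x :=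
    coe_derivX_iterate u
  change (∀ k T, _) ↔ ∀ k T, _
  simp only [e]

theorem solvesLax_evolution_iff {n N : ℕ} {α nu : 𝕜} {u g : RegFun 𝕜} {φ P : Fin N → RegFun 𝕜}
    (hφg : ∀ j, DecaysAtBot (φ j * g : RegFun 𝕜).1) (hP : ∀ j, IsPrimitive (P j) (φ j * g)) :
    (∀ x t, HasDerivAt (fun s => g.1 x s)
      (opQ n α (-(1 / 2) * α) u.1 (fun j => (φ j).1) nu g.1 x t) t)
      ↔ HasTimeDeriv g.1 (laxOp n α u φ P nu g).1 := by
  rw [opQ_eq n α u φ P nu g fun j => (hP j).coe_eq (hφg j)]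
  rfl

theorem solvesKdV_evolution_iff {n N : ℕ} {α : 𝕜} {u : RegFun 𝕜} {φ : Fin N → RegFun 𝕜} :
    (∀ x t, HasDerivAt (fun s => u.1 x s) (dx (fun y s => -2 * evalAt (bPoly 𝕜 (n + 2)) u.1 y s
      - 2 * α * ∑ j, (φ j).1 y s ^ 2) x t) t)
      ↔ HasTimeDeriv u.1 (derivX 𝕜 (-2 * bVal (derivX 𝕜) u (n + 2)
        - 2 * algebraMap 𝕜 _ α * ∑ j, φ j ^ 2)).1 := by
  have e : (fun y s => -2 * evalAt (bPoly 𝕜 (n + 2)) u.1 y s - 2 * α * ∑ j, (φ j).1 y s ^ 2)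
      = (-2 * bVal (derivX 𝕜) u (n + 2) - 2 * algebraMap 𝕜 _ α * ∑ j, φ j ^ 2 : RegFun 𝕜).1 := by
    refine ext_evalPt fun x t => ?_
    rw [evalAt_eq]
    simp only [map_sub, map_mul, map_neg, map_ofNat, map_sum, map_pow, AlgHom.commutes,
      Algebra.algebraMap_self, RingHom.id_apply]
    rfl
  rw [e]
  rfl

theorem exists_seedData {u f : RegFun 𝕜} {mu : 𝕜} (hu : BoundedAtBot u.1)
    (hf : SolvesSchrodinger u.1 mu f.1) (hff : ProductDecays f.1 f.1)
    (hτ : ∀ x t, tau f.1 x t ≠ 0) :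
    ∃ F w, SeedData u f F w mu ∧ tau f.1 = (1 + F).1 ∧ ∀ x t, w.1 x t = (tau f.1 x t)⁻¹ := by
  have hu' := boundedAtBot_iff.1 hu
  have hf' := solvesSchrodinger_iff.1 hf
  have hd := decPair_of_productDecays hu' hf' hf' hff
  obtain ⟨F, hF⟩ := exists_isPrimitive hd.mul
  have hτF : tau f.1 = (1 + F).1 := by
    funext x t
    change 1 + dinv (fun y s => f.1 y s ^ 2) x t = 1 + F.1 x t
    rw [hF.coe_eq (hd.mul 0)]
    simp only [pow_two]
    rfl
  have hmem : (tau f.1)⁻¹ ∈ RegFun 𝕜 := by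
    refine RegFun.inv_mem ?_ hτ
    rw [hτF]
    exact (1 + F).2
  refine ⟨F, ⟨_, hmem⟩, ⟨hu', hf', hd, hF, ?_⟩, hτF, fun x t => rfl⟩
  refine Subtype.ext (funext fun x => funext fun t => ?_)
  change (tau f.1 x t)⁻¹ * (1 + F).1 x t = 1
  rw [← hτF]
  exact inv_mul_cancel₀ (hτ x t)

section Coe

variable {f w F g S u : RegFun 𝕜}

theorem dtFun_eq (hw : ∀ x t, w.1 x t = (tau f.1 x t)⁻¹) (hS : S.1 = dinv (f * g : RegFun 𝕜).1) :
    dtFun f.1 g.1 = (g - f * w * S).1 := by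
  funext x t
  change g.1 x t - f.1 x t / tau f.1 x t * dinv (f * g : RegFun 𝕜).1 x t
    = g.1 x t - f.1 x t * w.1 x t * S.1 x t
  rw [hw, hS, div_eq_mul_inv]

theorem dtNew_eq (hw : ∀ x t, w.1 x t = (tau f.1 x t)⁻¹) : dtNew f.1 = (f * w).1 := by
  funext x t
  change f.1 x t / tau f.1 x t = f.1 x t * w.1 x t
  rw [hw, div_eq_mul_inv]

theorem dtPot_eq {mu : 𝕜} (s : SeedData u f F w mu) (hτ : tau f.1 = (1 + F).1)
    (hw : ∀ x t, w.1 x t = (tau f.1 x t)⁻¹) : dtPot f.1 u.1 = (newPot u f w).1 := by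
  have e : ∀ t, logDeriv (fun y => tau f.1 y t) = fun y => (f * f * w).1 y t := by
    intro t
    funext y
    have h1 : deriv (fun z => tau f.1 z t) y = (f * f).1 y t := by
      rw [hτ]
      have h2 : derivX 𝕜 (1 + F) = f * f := by
        rw [map_add, Derivation.map_one_eq_zero, zero_add, s.prim.deriv_eq]
      exact congrFun (congrFun (congrArg Subtype.val h2) y) t
    rw [logDeriv_apply, h1, div_eq_mul_inv, ← hw]
    rfl
  funext x t
  change u.1 x t + 2 * deriv (logDeriv (fun y => tau f.1 y t)) x
    = u.1 x t + 2 * dx (f * f * w).1 x t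
  rw [e]
  rfl

end Coe

/-- `g` is a regular eigenfunction of the potential `u` with spectral value `nu`. -/
structure IsEigen (u : ℝ → ℝ → 𝕜) (nu : 𝕜) (g : ℝ → ℝ → 𝕜) : Prop where
  mem : g ∈ RegFun 𝕜
  eqn : SolvesSchrodinger u nu g

/-- A regular solution of the `n`-th KdV equation with sources whose potential is bounded at
`x = -∞` together with its derivatives. -/
structure RegularSolution (n : ℕ) {N : ℕ} (α : 𝕜) (lam : Fin N → 𝕜) (u : ℝ → ℝ → 𝕜)
    (φ : Fin N → ℝ → ℝ → 𝕜) : Prop where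
  mem : u ∈ RegFun 𝕜
  bdd : BoundedAtBot u
  source_mem : ∀ j, φ j ∈ RegFun 𝕜
  kdv : SolvesKdV n α lam u φ

theorem RegularSolution.isEigen {n N : ℕ} {α : 𝕜} {lam : Fin N → 𝕜} {u : ℝ → ℝ → 𝕜}
    {φ : Fin N → ℝ → ℝ → 𝕜} (h : RegularSolution n α lam u φ) (j : Fin N) :
    IsEigen u (lam j) (φ j) := ⟨h.source_mem j, h.kdv.source j⟩

theorem ProductDecays.symm {g h : ℝ → ℝ → 𝕜} (p : ProductDecays g h) : ProductDecays h g := by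
  obtain ⟨p1, p2, p3, p4⟩ := p
  refine ⟨?_, ?_, ?_, ?_⟩
  · simpa only [mul_comm] using p1
  · simpa only [mul_comm] using p3
  · simpa only [mul_comm] using p2
  · simpa only [mul_comm] using p4

/-- The transformed sources: the images of the old ones followed by the new one. -/
def dtSrc {N : ℕ} (f : ℝ → ℝ → 𝕜) (φ : Fin N → ℝ → ℝ → 𝕜) : Fin (N + 1) → ℝ → ℝ → 𝕜 :=
  Fin.snoc (α := fun _ => ℝ → ℝ → 𝕜) (fun j => dtFun f (φ j)) (dtNew f)

section Seed

variable {u f : ℝ → ℝ → 𝕜} {mu : 𝕜}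

/-- A regular eigenfunction by which the transformation is possible. -/
structure IsSeed (u : ℝ → ℝ → 𝕜) (mu : 𝕜) (f : ℝ → ℝ → 𝕜) : Prop where
  mem : u ∈ RegFun 𝕜
  bdd : BoundedAtBot u
  eigen : IsEigen u mu f
  dec : ProductDecays f f
  tau_ne : ∀ x t, tau f x t ≠ 0

/-- The new source is the image of the seed itself. -/
theorem IsSeed.dtNew_eq_dtFun (hs : IsSeed u mu f) : dtNew f = dtFun f f := by
  funext x t
  have h := hs.tau_ne x t
  have e : dinv (fun y s => f y s * f y s) x t = tau f x t - 1 := by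
    simp only [tau, pow_two]
    ring
  rw [dtNew, dtFun, e]
  field_simp
  ring

theorem IsSeed.isEigen_dtFun (hs : IsSeed u mu f) {g : ℝ → ℝ → 𝕜} {nu : 𝕜} (hg : IsEigen u nu g)
    (hfg : ProductDecays f g) : IsEigen (dtPot f u) nu (dtFun f g) := by
  lift u to RegFun 𝕜 using hs.mem
  lift f to RegFun 𝕜 using hs.eigen.mem
  lift g to RegFun 𝕜 using hg.mem
  obtain ⟨F, w, s, hτ, hw⟩ := exists_seedData hs.bdd hs.eigen.eqn hs.dec hs.tau_ne
  have hg' := solvesSchrodinger_iff.1 hg.eqn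
  have pfg := decPair_of_productDecays s.bdd s.eigen hg' hfg
  obtain ⟨S, hS⟩ := exists_isPrimitive pfg.mul
  rw [dtPot_eq s hτ hw, dtFun_eq hw (hS.coe_eq (pfg.mul 0))]
  exact ⟨Subtype.mem _, solvesSchrodinger_iff.2 (s.eigen_transform hg' pfg hS)⟩

theorem IsSeed.productDecays_dtFun (hs : IsSeed u mu f) {g h : ℝ → ℝ → 𝕜} {nu nu' : 𝕜}
    (hg : IsEigen u nu g) (hh : IsEigen u nu' h) (hfg : ProductDecays f g)
    (hfh : ProductDecays f h) (hgh : ProductDecays g h) :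
    ProductDecays (dtFun f g) (dtFun f h) ∧
    ∀ x t, dinv (fun y s => dtFun f g y s * dtFun f h y s) x t
      = dinv (fun y s => g y s * h y s) x t
        - dinv (fun y s => f y s * g y s) x t / tau f x t
          * dinv (fun y s => f y s * h y s) x t := by
  lift u to RegFun 𝕜 using hs.mem
  lift f to RegFun 𝕜 using hs.eigen.mem
  lift g to RegFun 𝕜 using hg.mem
  lift h to RegFun 𝕜 using hh.mem
  obtain ⟨F, w, s, hτ, hw⟩ := exists_seedData hs.bdd hs.eigen.eqn hs.dec hs.tau_ne
  have hg' := solvesSchrodinger_iff.1 hg.eqn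
  have hh' := solvesSchrodinger_iff.1 hh.eqn
  have pfg := decPair_of_productDecays s.bdd s.eigen hg' hfg
  have pfh := decPair_of_productDecays s.bdd s.eigen hh' hfh
  have pgh := decPair_of_productDecays s.bdd hg' hh' hgh
  obtain ⟨S, hS⟩ := exists_isPrimitive pfg.mul
  obtain ⟨R, hR⟩ := exists_isPrimitive pfh.mul
  obtain ⟨P, hP⟩ := exists_isPrimitive pgh.mul
  have p := s.decPair_transform pgh pfg pfh hS hR
  have hp := s.prim_transform pfg hR hS hP
  rw [dtFun_eq hw (hS.coe_eq (pfg.mul 0)), dtFun_eq hw (hR.coe_eq (pfh.mul 0))]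
  refine ⟨p.productDecays, fun x t => ?_⟩
  have h1 := congrFun (congrFun (hp.coe_eq (p.mul 0)) x) t
  have h2 := congrFun (congrFun (hS.coe_eq (pfg.mul 0)) x) t
  have h3 := congrFun (congrFun (hR.coe_eq (pfh.mul 0)) x) t
  have h4 := congrFun (congrFun (hP.coe_eq (pgh.mul 0)) x) t
  refine h1.symm.trans ?_
  change P.1 x t - S.1 x t * w.1 x t * R.1 x t = _
  rw [hw, h2, h3, h4, ← div_eq_mul_inv]
  rfl

section Flow

variable {n N : ℕ} {α : 𝕜} {lam : Fin N → 𝕜} {φ : Fin N → ℝ → ℝ → 𝕜}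

theorem exists_source_primitives {φ : Fin N → RegFun 𝕜} {g : RegFun 𝕜}
    (h : ∀ j, DecPair (φ j) g) : ∃ P : Fin N → RegFun 𝕜, ∀ j, IsPrimitive (P j) (φ j * g) :=
  Classical.skolem.1 fun j => exists_isPrimitive (h j).mul

theorem dtSrc_eq {f w : RegFun 𝕜} {φ R : Fin N → RegFun 𝕜}
    (hw : ∀ x t, w.1 x t = (tau f.1 x t)⁻¹) (hφf : ∀ j, DecPair (φ j) f)
    (hR : ∀ j, IsPrimitive (R j) (φ j * f)) :
    dtSrc f.1 (fun j => (φ j).1) = fun j => ((Fin.snoc (α := fun _ => RegFun 𝕜)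
      (fun j => φ j - f * w * R j) (f * w) : Fin (N + 1) → RegFun 𝕜) j).1 := by
  funext j
  refine Fin.lastCases ?_ (fun j => ?_) j
  · simp only [dtSrc, Fin.snoc_last]
    exact dtNew_eq hw
  · simp only [dtSrc, Fin.snoc_castSucc]
    refine dtFun_eq hw ?_
    rw [(hR j).coe_eq ((hφf j).mul 0), mul_comm]

theorem IsSeed.regularSolution_dt (hs : IsSeed u mu f) (hsol : RegularSolution n α lam u φ)
    (hφf : ∀ j, ProductDecays (φ j) f) (hf : SolvesLax n α (-(1 / 2) * α) u φ mu f) :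
    RegularSolution n α (Fin.snoc (α := fun _ => 𝕜) lam mu) (dtPot f u) (dtSrc f φ) := by
  have hsrc : ∀ j, IsEigen (dtPot f u) ((Fin.snoc (α := fun _ => 𝕜) lam mu : Fin (N + 1) → 𝕜) j)
      (dtSrc f φ j) := by
    intro j
    refine Fin.lastCases ?_ (fun j => ?_) j
    · simp only [dtSrc, Fin.snoc_last]
      rw [hs.dtNew_eq_dtFun]
      exact hs.isEigen_dtFun hs.eigen hs.dec
    · simp only [dtSrc, Fin.snoc_castSucc]
      exact hs.isEigen_dtFun (hsol.isEigen j) (hφf j).symm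
  lift u to RegFun 𝕜 using hs.mem
  lift f to RegFun 𝕜 using hs.eigen.mem
  obtain ⟨φ, rfl⟩ : ∃ φ' : Fin N → RegFun 𝕜, φ = fun j => (φ' j).1 :=
    ⟨fun j => ⟨φ j, hsol.source_mem j⟩, rfl⟩
  obtain ⟨F, w, s, hτ, hw⟩ := exists_seedData hs.bdd hs.eigen.eqn hs.dec hs.tau_ne
  have pφf : ∀ j, DecPair (φ j) f := fun j => decPair_of_productDecays s.bdd
    (solvesSchrodinger_iff.1 (hsol.kdv.source j)) s.eigen (hφf j)
  obtain ⟨R, hR⟩ := exists_source_primitives pφf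
  have tf := (solvesLax_evolution_iff (fun j => (pφf j).mul 0) hR).1 hf.evolution
  have tu := solvesKdV_evolution_iff.1 hsol.kdv.evolution
  have key := solvesKdV_evolution_iff.2 (s.source_transform pφf hR tf tu)
  rw [dtPot_eq s hτ hw] at hsrc ⊢
  rw [dtSrc_eq hw pφf hR] at hsrc ⊢
  exact ⟨Subtype.mem _, boundedAtBot_iff.2 s.newPot_mem_bdd, fun j => (hsrc j).mem,
    RegFun.contDiff (Subtype.mem _), key, fun j => (hsrc j).eqn⟩

theorem IsSeed.solvesLax_dt (hs : IsSeed u mu f) (hsol : RegularSolution n α lam u φ)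
    (hφf : ∀ j, ProductDecays (φ j) f) (hf : SolvesLax n α (-(1 / 2) * α) u φ mu f)
    {g : ℝ → ℝ → 𝕜} {nu : 𝕜} (hg : IsEigen u nu g) (hfg : ProductDecays f g)
    (hφg : ∀ j, ProductDecays (φ j) g) (hgl : SolvesLax n α (-(1 / 2) * α) u φ nu g) :
    SolvesLax n α (-(1 / 2) * α) (dtPot f u) (dtSrc f φ) nu (dtFun f g) := by
  have hdec : ∀ j, ProductDecays (dtSrc f φ j) (dtFun f g) := by
    intro j
    refine Fin.lastCases ?_ (fun j => ?_) j
    · simp only [dtSrc, Fin.snoc_last]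
      rw [hs.dtNew_eq_dtFun]
      exact (hs.productDecays_dtFun hs.eigen hg hs.dec hfg hfg).1
    · simp only [dtSrc, Fin.snoc_castSucc]
      exact (hs.productDecays_dtFun (hsol.isEigen j) hg (hφf j).symm hfg (hφg j)).1
  have heig := hs.isEigen_dtFun hg hfg
  have hreg := hs.regularSolution_dt hsol hφf hf
  refine ⟨heig.eqn, fun j x t => (hdec j).1.integrableOn
    ((xDiff_of_mem (hreg.source_mem j)).1.mul (xDiff_of_mem heig.mem).1) x t, ?_⟩
  lift u to RegFun 𝕜 using hs.mem
  lift f to RegFun 𝕜 using hs.eigen.mem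
  lift g to RegFun 𝕜 using hg.mem
  obtain ⟨φ, rfl⟩ : ∃ φ' : Fin N → RegFun 𝕜, φ = fun j => (φ' j).1 :=
    ⟨fun j => ⟨φ j, hsol.source_mem j⟩, rfl⟩
  obtain ⟨F, w, s, hτ, hw⟩ := exists_seedData hs.bdd hs.eigen.eqn hs.dec hs.tau_ne
  have hg' := solvesSchrodinger_iff.1 hg.eqn
  have hφ' := fun j => solvesSchrodinger_iff.1 (hsol.kdv.source j)
  have pφf : ∀ j, DecPair (φ j) f := fun j => decPair_of_productDecays s.bdd (hφ' j) s.eigen (hφf j)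
  have pφg : ∀ j, DecPair (φ j) g := fun j => decPair_of_productDecays s.bdd (hφ' j) hg' (hφg j)
  have pfg := decPair_of_productDecays s.bdd s.eigen hg' hfg
  obtain ⟨R, hR⟩ := exists_source_primitives pφf
  obtain ⟨P, hP⟩ := exists_source_primitives pφg
  obtain ⟨S, hS⟩ := exists_isPrimitive pfg.mul
  have tf := (solvesLax_evolution_iff (fun j => (pφf j).mul 0) hR).1 hf.evolution
  have tg := (solvesLax_evolution_iff (fun j => (pφg j).mul 0) hP).1 hgl.evolution
  have key := s.lax_transform pφf hR tf hg' pfg pφg hP hS tg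
  rw [dtSrc_eq hw pφf hR, dtPot_eq s hτ hw, dtFun_eq hw (hS.coe_eq (pfg.mul 0))]
  rw [dtSrc_eq hw pφf hR, dtFun_eq hw (hS.coe_eq (pfg.mul 0))] at hdec
  refine (solvesLax_evolution_iff (fun j => (hdec j).1) fun j => ?_).2 key
  refine Fin.lastCases ?_ (fun j => ?_) j
  · simp only [Fin.snoc_last]
    have h1 := s.prim_transform s.dec hS s.prim hS
    have h2 := s.inv
    have e1 : f - f * w * F = f * w := by linear_combination -f * h2
    have e2 : S - F * w * S = w * S := by linear_combination -S * h2
    rwa [e1, e2] at h1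
  · simp only [Fin.snoc_castSucc]
    have hR' : IsPrimitive (R j) (f * φ j) := by
      rw [mul_comm]
      exact hR j
    exact s.prim_transform (pφf j).symm hS hR' (hP j)

end Flow
end Seed
end StepOnFunctions

/-! ### Determinants and integral-type Wronskians -/

section Determinants

variable {K : Type*} [Field K]

/-- Column elimination: `d` expresses the upper part of the last column through the other columns.
No block has to be invertible. -/
theorem det_eq_of_solution {m : ℕ} (T : Matrix (Fin (m + 1)) (Fin (m + 1)) K) (d : Fin m → K)
    (hd : ∀ i : Fin m, ∑ k : Fin m, T i.castSucc k.castSucc * d k = T i.castSucc (Fin.last m)) :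
    T.det = (T.submatrix Fin.castSucc Fin.castSucc).det
      * (T (Fin.last m) (Fin.last m) - ∑ k : Fin m, T (Fin.last m) k.castSucc * d k) := by
  let c : Fin (m + 1) → K := Fin.snoc (α := fun _ => K) (fun k => -d k) 1
  have h1 := Matrix.det_updateCol_sum T (Fin.last m) c
  have hc : c (Fin.last m) = 1 := Fin.snoc_last (α := fun _ => K) _ _
  have hcc : ∀ k : Fin m, c k.castSucc = -d k := fun k => Fin.snoc_castSucc (α := fun _ => K) _ _ k
  rw [hc, one_smul] at h1
  rw [← h1, Matrix.det_succ_column _ (Fin.last m), Fin.sum_univ_castSucc]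
  have hval : ∀ i, ∑ k, c k • T i k
      = T i (Fin.last m) - ∑ k : Fin m, T i k.castSucc * d k := by
    intro i
    rw [Fin.sum_univ_castSucc, hc]
    simp only [hcc, smul_eq_mul, one_mul, neg_mul, Finset.sum_neg_distrib, mul_comm (d _)]
    ring
  have hz : ∀ i : Fin m, ((-1 : K) ^ ((i.castSucc : ℕ) + (Fin.last m : ℕ))
      * (T.updateCol (Fin.last m) fun k => ∑ i, c i • T k i) i.castSucc (Fin.last m)
      * ((T.updateCol (Fin.last m) fun k => ∑ i, c i • T k i).submatrix i.castSucc.succAbove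
        (Fin.last m).succAbove).det) = 0 := by
    intro i
    rw [Matrix.updateCol_self, hval, hd, sub_self, mul_zero, zero_mul]
  rw [Finset.sum_eq_zero fun i _ => hz i, zero_add, Matrix.updateCol_self, hval]
  have e1 : (-1 : K) ^ ((Fin.last m : ℕ) + (Fin.last m : ℕ)) = 1 := by
    rw [← two_mul, pow_mul]; simp
  have e2 : (T.updateCol (Fin.last m) fun k => ∑ i, c i • T k i).submatrix (Fin.last m).succAbove
      (Fin.last m).succAbove = T.submatrix Fin.castSucc Fin.castSucc := by
    ext i j
    simp [Fin.succAbove_last, Fin.castSucc_ne_last]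
  rw [e1, e2, one_mul, mul_comm]

/-- Cramer's rule for the system `M c = M e_j - e_j`, without an assumption on `det M`. -/
theorem det_updateRow_of_solution {m : ℕ} (M : Matrix (Fin m) (Fin m) K) (r c : Fin m → K)
    (j : Fin m) (hc : ∀ i, ∑ k, M i k * c k = M i j - if i = j then 1 else 0) :
    (M.updateRow j r).det = M.det * (r j - ∑ k, r k * c k) := by
  have h1 : M.mulVec (Pi.single j 1 - c) = Pi.single j 1 := by
    funext i
    rw [Matrix.mulVec_sub, Pi.sub_apply, Matrix.mulVec_single_one]
    change M i j - ∑ k, M i k * c k = _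
    rw [hc, Pi.single_apply]
    ring
  have h2 : M.adjugate.mulVec (Pi.single j 1) = M.det • (Pi.single j 1 - c) := by
    rw [← h1, Matrix.mulVec_mulVec, Matrix.adjugate_mul, Matrix.smul_mulVec, Matrix.one_mulVec, h1]
  rw [← Matrix.cramer_transpose_apply, Matrix.cramer_eq_adjugate_mulVec,
    ← Matrix.adjugate_transpose]
  have h3 : ∀ k, M.adjugate k j = M.det * ((Pi.single j 1 : Fin m → K) k - c k) := by
    intro k
    have := congrFun h2 k
    rwa [Matrix.mulVec_single_one] at this
  change ∑ k, M.adjugate k j * r k = _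
  have h4 : ∑ k, r k * (Pi.single j 1 : Fin m → K) k = r j := by
    simp [Pi.single_apply]
  rw [← h4, ← Finset.sum_sub_distrib, Finset.mul_sum]
  refine Finset.sum_congr rfl fun k _ => ?_
  rw [h3]
  ring

end Determinants

section Wronskians

variable {𝕜 : Type*} [RCLike 𝕜]

/-- `∂⁻¹(g h)`. -/
def pair (g h : ℝ → ℝ → 𝕜) : ℝ → ℝ → 𝕜 := dinv fun y s => g y s * h y s

theorem pair_comm (g h : ℝ → ℝ → 𝕜) : pair g h = pair h g := by
  simp only [pair, mul_comm]

/-- The coefficients `c` solve the linear system `(δ_ij + ∂⁻¹(f_i f_j)) c = (∂⁻¹(f_i g))`. -/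
def IsCoeff {m : ℕ} (f : Fin m → ℝ → ℝ → 𝕜) (g : ℝ → ℝ → 𝕜) (c : Fin m → ℝ → ℝ → 𝕜) : Prop :=
  ∀ i x t, c i x t + ∑ k, pair (f i) (f k) x t * c k x t = pair (f i) g x t

/-- The matrix `δ_ij + ∂⁻¹(f_i f_j)` of `W1` at a point. -/
def gramMat {m : ℕ} (f : Fin m → ℝ → ℝ → 𝕜) (x t : ℝ) : Matrix (Fin m) (Fin m) 𝕜 :=
  Matrix.of fun i j => (if i = j then 1 else 0) + pair (f i) (f j) x t

theorem IsCoeff.sum_gramMat {m : ℕ} {f : Fin m → ℝ → ℝ → 𝕜} {g : ℝ → ℝ → 𝕜}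
    {c : Fin m → ℝ → ℝ → 𝕜} (h : IsCoeff f g c) (i : Fin m) (x t : ℝ) :
    ∑ k, gramMat f x t i k * c k x t = pair (f i) g x t := by
  rw [← h i x t]
  simp [gramMat, add_mul, Finset.sum_add_distrib]

/-- `W1(f_1, …, f_{m+1}) = W1(f_1, …, f_m) τ`, where `τ` belongs to the seed of step `m + 1`. -/
theorem W1_succ {m : ℕ} {f : Fin (m + 1) → ℝ → ℝ → 𝕜} {d : Fin m → ℝ → ℝ → 𝕜}
    (hd : IsCoeff (fun i => f i.castSucc) (f (Fin.last m)) d) (x t : ℝ) :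
    W1 f x t = W1 (fun i => f i.castSucc) x t
      * (1 + pair (f (Fin.last m)) (f (Fin.last m)) x t
        - ∑ k, pair (f (Fin.last m)) (f k.castSucc) x t * d k x t) := by
  have h := det_eq_of_solution (gramMat f x t) (fun k => d k x t) fun i => by
    have h1 := hd.sum_gramMat i x t
    have e : ∀ k : Fin m, gramMat f x t i.castSucc k.castSucc
        = gramMat (fun i => f i.castSucc) x t i k := fun k => by simp [gramMat]
    simp only [e, h1]
    simp [gramMat, Fin.castSucc_ne_last]
  have e1 : (gramMat f x t).submatrix Fin.castSucc Fin.castSucc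
      = gramMat (fun i => f i.castSucc) x t := by
    ext i k
    simp [gramMat]
  rw [e1] at h
  have e2 : ∀ k : Fin m, gramMat f x t (Fin.last m) k.castSucc
      = pair (f (Fin.last m)) (f k.castSucc) x t := fun k => by
    simp [gramMat, (Fin.castSucc_ne_last k).symm]
  simp only [e2] at h
  rw [show gramMat f x t (Fin.last m) (Fin.last m)
    = 1 + pair (f (Fin.last m)) (f (Fin.last m)) x t by simp [gramMat]] at h
  exact h

theorem W2_appendLast {m : ℕ} {f : Fin m → ℝ → ℝ → 𝕜} {g : ℝ → ℝ → 𝕜} {c : Fin m → ℝ → ℝ → 𝕜}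
    (hc : IsCoeff f g c) (x t : ℝ) :
    W2 (appendLast f g) x t = W1 f x t * (g x t - ∑ k, f k x t * c k x t) := by
  have ea : ∀ k : Fin m, appendLast f g k.castSucc = f k := fun k =>
    Fin.snoc_castSucc (α := fun _ => ℝ → ℝ → 𝕜) _ _ k
  have el : appendLast f g (Fin.last m) = g := Fin.snoc_last (α := fun _ => ℝ → ℝ → 𝕜) _ _
  have hne : ∀ i : Fin m, ¬ (i : ℕ) = m := fun i => i.2.ne
  rw [W2, det_eq_of_solution _ (fun k => c k x t)]
  · congr 1
    · refine congrArg Matrix.det ?_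
      ext i k
      simp [ea, hne]
    · simp [ea, el]
  · intro i
    have h1 := hc.sum_gramMat i x t
    simp only [Matrix.of_apply, Fin.val_castSucc, Nat.add_right_cancel_iff, hne, if_false, ea, el,
      Fin.castSucc_ne_last, zero_add, Fin.castSucc_inj]
    exact h1

/-- The list with `f_j` moved to the end gives a simultaneous permutation of the rows and columns of
the matrix of `W1`, with its `j`-th row replaced by `f`. -/
theorem W2_moveLast {m : ℕ} {f : Fin m → ℝ → ℝ → 𝕜} (j : Fin m) {c : Fin m → ℝ → ℝ → 𝕜}
    (hc : IsCoeff f (f j) c) (x t : ℝ) :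
    W2 (moveLast f j) x t = W1 f x t * (f j x t - ∑ k, f k x t * c k x t) := by
  let σ : Fin m → Fin m := fun i =>
    if i < j then i else if h : (i : ℕ) + 1 < m then ⟨i + 1, h⟩ else j
  have hσ : moveLast f j = fun i => f (σ i) := by
    funext i
    simp only [moveLast, σ]
    split_ifs <;> rfl
  have hσj : ∀ i, σ i = j ↔ (i : ℕ) + 1 = m := by
    intro i
    simp only [σ, Fin.ext_iff]
    have := i.2
    have := j.2
    split_ifs with h1 h2
    · rw [Fin.lt_def] at h1; omega
    · rw [Fin.lt_def] at h1; simp only; omega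
    · simp only [true_iff]; omega
  have hinj : Function.Injective σ := by
    intro a b hab
    have ha := a.2
    have hb := b.2
    have hj := j.2
    simp only [σ, Fin.ext_iff] at hab
    apply Fin.ext
    simp only [Fin.lt_def] at hab
    split_ifs at hab <;> (try simp only at hab) <;> omega
  let e : Fin m ≃ Fin m := Equiv.ofBijective σ (Finite.injective_iff_bijective.1 hinj)
  have h1 := det_updateRow_of_solution (gramMat f x t) (fun k => f k x t) (fun k => c k x t) j
    fun i => by
      rw [hc.sum_gramMat i x t]
      simp [gramMat]
  rw [← Matrix.det_submatrix_equiv_self e] at h1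
  rw [show W1 f x t = (gramMat f x t).det from rfl, ← h1, W2, hσ]
  congr 1
  ext i k
  change (if (i : ℕ) + 1 = m then f (σ k) x t else _) = (gramMat f x t).updateRow j _ (σ i) (σ k)
  rw [Matrix.updateRow_apply]
  simp only [hσj]
  split_ifs with h2 h3
  · rfl
  · subst h3
    simp [gramMat, pair]
  · have : σ i ≠ σ k := fun h => h3 (hinj h)
    simp [gramMat, pair, this]

/-- For real-valued functions the matrix is the identity plus a Gram matrix. -/
theorem W1_ne_zero_of_real {m : ℕ} {f : Fin m → ℝ → ℝ → 𝕜} (hf : ∀ i, f i ∈ RegFun 𝕜)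
    (hff : ∀ i k, ProductDecays (f i) (f k)) (him : ∀ i x t, RCLike.im (f i x t) = 0) (x t : ℝ) :
    W1 f x t ≠ 0 := by
  intro h0
  obtain ⟨v, hv, hMv⟩ := Matrix.exists_mulVec_eq_zero_iff.2 (show (gramMat f x t).det = 0 from h0)
  have hconj : ∀ i y, (starRingEnd 𝕜) (f i y t) = f i y t := fun i y =>
    RCLike.conj_eq_iff_im.2 (him i y t)
  have hint : ∀ i k, IntegrableOn (fun y => f i y t * f k y t) (Iic x) := fun i k =>
    (hff i k).1.integrableOn ((xDiff_of_mem (hf i)).1.mul (xDiff_of_mem (hf k)).1) x t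
  have e1 : ∑ i, ∑ k, (starRingEnd 𝕜) (v i) * v k * pair (f i) (f k) x t
      = ∫ y in Iic x, ((‖∑ k, v k * f k y t‖ ^ 2 : ℝ) : 𝕜) := by
    have : ∀ y, ((‖∑ k, v k * f k y t‖ ^ 2 : ℝ) : 𝕜)
        = ∑ i, ∑ k, (starRingEnd 𝕜) (v i) * v k * (f i y t * f k y t) := by
      intro y
      rw [RCLike.ofReal_pow, ← RCLike.conj_mul, map_sum, Finset.sum_mul]
      refine Finset.sum_congr rfl fun i _ => ?_
      rw [Finset.mul_sum]
      refine Finset.sum_congr rfl fun k _ => ?_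
      rw [map_mul, hconj]
      ring
    simp only [this]
    rw [integral_finsetSum _ fun i _ => integrable_finsetSum _ fun k _ => (hint i k).const_mul _]
    refine Finset.sum_congr rfl fun i _ => ?_
    rw [integral_finsetSum _ fun k _ => (hint i k).const_mul _]
    refine Finset.sum_congr rfl fun k _ => ?_
    rw [integral_const_mul]
    rfl
  have e2 : ∑ i, (starRingEnd 𝕜) (v i) * (gramMat f x t).mulVec v i
      = ((∑ i, ‖v i‖ ^ 2 + ∫ y in Iic x, ‖∑ k, v k * f k y t‖ ^ 2 : ℝ) : 𝕜) := by
    rw [RCLike.ofReal_add, ← integral_ofReal, ← e1, RCLike.ofReal_sum, ← Finset.sum_add_distrib]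
    refine Finset.sum_congr rfl fun i _ => ?_
    rw [RCLike.ofReal_pow, ← RCLike.conj_mul]
    change _ * ∑ k, gramMat f x t i k * v k = _
    simp only [gramMat, Matrix.of_apply, add_mul, ite_mul, one_mul, zero_mul,
      Finset.sum_add_distrib, Finset.sum_ite_eq, Finset.mem_univ, if_true, mul_add, Finset.mul_sum]
    congr 1
    exact Finset.sum_congr rfl fun k _ => by ring
  rw [hMv] at e2
  simp only [Pi.zero_apply, mul_zero, Finset.sum_const_zero] at e2
  have e3 : ∑ i, ‖v i‖ ^ 2 + ∫ y in Iic x, ‖∑ k, v k * f k y t‖ ^ 2 = 0 := by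
    exact_mod_cast e2.symm
  have e4 : 0 ≤ ∫ y in Iic x, ‖∑ k, v k * f k y t‖ ^ 2 :=
    integral_nonneg fun y => by positivity
  have e5 : ∑ i, ‖v i‖ ^ 2 = 0 := by
    have : 0 ≤ ∑ i, ‖v i‖ ^ 2 := Finset.sum_nonneg fun i _ => by positivity
    linarith
  refine hv (funext fun i => ?_)
  have := (Finset.sum_eq_zero_iff_of_nonneg fun i _ => by positivity).1 e5 i (Finset.mem_univ i)
  simpa using this

end Wronskians

/-! ### Iteration -/

section Iteration

variable {𝕜 : Type*} [RCLike 𝕜] {n N : ℕ} {α : 𝕜} {lam : Fin N → 𝕜} {u : ℝ → ℝ → 𝕜}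
  {φ : Fin N → ℝ → ℝ → 𝕜}

theorem dxxLog_mul {g h : ℝ → ℝ → 𝕜} (hg : g ∈ RegFun 𝕜) (hh : h ∈ RegFun 𝕜)
    (hg0 : ∀ x t, g x t ≠ 0) (hh0 : ∀ x t, h x t ≠ 0) (x t : ℝ) :
    dxxLog (fun y s => g y s * h y s) x t = dxxLog g x t + dxxLog h x t := by
  have e : logDeriv (fun y => g y t * h y t)
      = logDeriv (fun y => g y t) + logDeriv (fun y => h y t) := by
    funext y
    exact logDeriv_mul y (hg0 y t) (hh0 y t) ((xDiff_of_mem hg).2 y t) ((xDiff_of_mem hh).2 y t)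
  have hd : ∀ {k : ℝ → ℝ → 𝕜}, k ∈ RegFun 𝕜 → (∀ x t, k x t ≠ 0) →
      DifferentiableAt ℝ (logDeriv fun y => k y t) x := by
    intro k hk hk0
    exact ((xDiff_of_mem (RegFun.dx_mem hk)).2 x t).div ((xDiff_of_mem hk).2 x t) (hk0 x t)
  rw [dxxLog, e]
  exact deriv_add (hd hg hg0) (hd hh hh0)

/-- The properties of the `m`-fold transformation with the seeds `f`, in which the transformed
functions are `g - ∑ f_k c_k` with coefficients `c` that solve a linear system. -/
structure IterSpec (n : ℕ) {N m : ℕ} (α : 𝕜) (lam : Fin N → 𝕜) (mu : Fin m → 𝕜) (u : ℝ → ℝ → 𝕜)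
    (φ : Fin N → ℝ → ℝ → 𝕜) (f : Fin m → ℝ → ℝ → 𝕜) : Prop where
  sol : RegularSolution n α (Fin.append lam mu) (iterPot m f u) (iterSrc φ m f)
  eigen : ∀ g nu, IsEigen u nu g → (∀ i, ProductDecays (f i) g) →
    IsEigen (iterPot m f u) nu (iterFun m f g)
  coeff : ∀ g nu, IsEigen u nu g → (∀ i, ProductDecays (f i) g) → ∃ c, IsCoeff f g c ∧
    (∀ x t, iterFun m f g x t = g x t - ∑ k, f k x t * c k x t) ∧
    ∀ h nu', IsEigen u nu' h → (∀ i, ProductDecays (f i) h) → ProductDecays h g →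
      ProductDecays (iterFun m f h) (iterFun m f g) ∧
      ∀ x t, pair (iterFun m f h) (iterFun m f g) x t
        = pair h g x t - ∑ k, pair h (f k) x t * c k x t
  lax : ∀ g nu, IsEigen u nu g → (∀ i, ProductDecays (f i) g) → (∀ j, ProductDecays (φ j) g) →
    SolvesLax n α (-(1 / 2) * α) u φ nu g →
    SolvesLax n α (-(1 / 2) * α) (iterPot m f u) (iterSrc φ m f) nu (iterFun m f g)
  src : ∀ j, iterSrc φ m f (Fin.castAdd m j) = iterFun m f (φ j)
  new : ∀ j, iterSrc φ m f (Fin.natAdd N j) = iterFun m f (f j)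
  W1_mem : W1 f ∈ RegFun 𝕜
  pot : ∀ x t, iterPot m f u x t = u x t + 2 * dxxLog (W1 f) x t

theorem W1_zero (f : Fin 0 → ℝ → ℝ → 𝕜) : W1 f = fun _ _ => 1 := by
  funext x t
  exact Matrix.det_fin_zero

theorem iterSpec_zero (hsol : RegularSolution n α lam u φ) (mu : Fin 0 → 𝕜)
    (f : Fin 0 → ℝ → ℝ → 𝕜) : IterSpec n α lam mu u φ f where
  sol := by
    have e : Fin.append lam mu = lam := by
      funext j
      exact Fin.append_left lam mu j
    rw [e]
    exact hsol
  eigen g nu hg _ := hg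
  coeff g nu _ _ := ⟨fun i => i.elim0, fun i => i.elim0, fun x t => by simp [iterFun],
    fun h nu' _ _ hhg => ⟨hhg, fun x t => by simp [iterFun]⟩⟩
  lax g nu _ _ _ hl := hl
  src j := rfl
  new j := j.elim0
  W1_mem := by
    rw [W1_zero]
    exact (RegFun 𝕜).one_mem
  pot x t := by
    have : logDeriv (fun _ : ℝ => (1 : 𝕜)) = fun _ => 0 := by
      funext y
      simp [logDeriv_apply]
    simp [iterPot, W1_zero, dxxLog, this]

/-- The last seed `f_{m+1}`, carried through `m` steps, is an admissible seed for one more step,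
because its `τ` is a quotient of consecutive values of `W1`. If `g[m] = g - ∑ c_k f_k` and
`f_{m+1}[m] = f_{m+1} - ∑ d_k f_k`, then the coefficients of `g[m+1]` are `c - s d` and `s`, with
`s = ∂⁻¹(f_{m+1}[m] g[m]) / τ`. -/
theorem iterSpec (hsol : RegularSolution n α lam u φ) : ∀ (m : ℕ) (f : Fin m → ℝ → ℝ → 𝕜)
    (mu : Fin m → 𝕜), (∀ i, IsEigen u (mu i) (f i)) → (∀ j i, ProductDecays (φ j) (f i)) →
    (∀ i k, ProductDecays (f i) (f k)) →
    (∀ i, SolvesLax n α (-(1 / 2) * α) u φ (mu i) (f i)) →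
    (∀ (i : ℕ) (hi : i ≤ m) (x t : ℝ), W1 (fun k : Fin i => f (Fin.castLE hi k)) x t ≠ 0) →
    IterSpec n α lam mu u φ f := by
  intro m
  induction m with
  | zero => exact fun f mu _ _ _ _ _ => iterSpec_zero hsol mu f
  | succ m ih =>
    intro f mu hf hφf hff hlax hW
    set f' : Fin m → ℝ → ℝ → 𝕜 := fun i => f i.castSucc with hf'
    set p := f (Fin.last m) with hp
    have spec : IterSpec n α lam (fun i => mu i.castSucc) u φ f' :=
      ih f' _ (fun i => hf _) (fun j i => hφf j _) (fun i k => hff _ _) (fun i => hlax _)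
        fun i hi x t => hW i (hi.trans m.le_succ) x t
    have hpe := hf (Fin.last m)
    have hpf : ∀ i, ProductDecays (f' i) p := fun i => hff _ _
    obtain ⟨d, hd, hdp, hdd⟩ := spec.coeff p _ hpe hpf
    have hpp := hdd p _ hpe hpf (hff _ _)
    set q := iterFun m f' p with hq
    have hτ : ∀ x t, tau q x t = 1 + pair q q x t := fun x t => by simp only [tau, pair, pow_two]
    have hW1 : ∀ x t, W1 f x t = W1 f' x t * tau q x t := by
      intro x t
      rw [W1_succ hd, hτ, hpp.2]
      simp only [hf', hp]
      ring
    have hWf : ∀ x t, W1 f x t ≠ 0 := fun x t => hW (m + 1) le_rfl x t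
    have hWf' : ∀ x t, W1 f' x t ≠ 0 := fun x t => hW m m.le_succ x t
    -- the next step is defined because `τ` is a quotient of consecutive values of `W1`
    have hτ0 : ∀ x t, tau q x t ≠ 0 := fun x t => right_ne_zero_of_mul (hW1 x t ▸ hWf x t)
    have hseed : IsSeed (iterPot m f' u) (mu (Fin.last m)) q :=
      ⟨spec.sol.mem, spec.sol.bdd, spec.eigen p _ hpe hpf, hpp.1, hτ0⟩
    have hqlax := spec.lax p _ hpe hpf (fun j => hφf j _) (hlax _)
    have hsrc : ∀ g nu, IsEigen u nu g → (∀ i, ProductDecays (f i) g) →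
        (∀ j, ProductDecays (φ j) g) →
        ∀ j, ProductDecays (iterSrc φ m f' j) (iterFun m f' g) := by
      intro g nu hg hfg hφg j
      obtain ⟨c, _, _, hc⟩ := spec.coeff g nu hg fun i => hfg _
      refine Fin.addCases (fun j => ?_) (fun j => ?_) j
      · rw [spec.src]
        exact (hc _ _ (hsol.isEigen j) (fun i => (hφf j _).symm) (hφg j)).1
      · rw [spec.new]
        exact (hc _ _ (hf _) (fun i => hff _ _) (hfg _)).1
    have hqsrc := hsrc p _ hpe (fun i => hff _ _) fun j => hφf j _
    have hqg : ∀ g nu, IsEigen u nu g → (∀ i, ProductDecays (f i) g) →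
        ProductDecays q (iterFun m f' g) ∧
        ∀ x t, pair q (iterFun m f' g) x t = pair p g x t - ∑ k, pair g (f' k) x t * d k x t := by
      intro g nu hg hfg
      obtain ⟨h1, h2⟩ := hdd g nu hg (fun i => hfg _) (hfg _).symm
      refine ⟨h1.symm, fun x t => ?_⟩
      rw [pair_comm, h2, pair_comm p]
    have hτmem : tau q ∈ RegFun 𝕜 := by
      have h1 : (1 : ℝ → ℝ → 𝕜) + pair q q ∈ RegFun 𝕜 := (RegFun 𝕜).add_mem (RegFun 𝕜).one_mem
        (hpp.1.1.dinv_mem ((RegFun 𝕜).mul_mem hseed.eigen.mem hseed.eigen.mem))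
      have h2 : tau q = 1 + pair q q := by
        funext x t
        exact hτ x t
      rwa [h2]
    have hW1' : W1 f = fun x t => W1 f' x t * tau q x t := by
      funext x t
      exact hW1 x t
    refine ⟨?_, ?_, ?_, ?_, ?_, ?_, ?_, ?_⟩
    · have e : Fin.append lam mu = Fin.snoc (α := fun _ => 𝕜)
          (Fin.append lam fun i => mu i.castSucc) (mu (Fin.last m)) := by
        rw [← Fin.append_snoc]
        congr 1
        exact (Fin.snoc_init_self (α := fun _ => 𝕜) mu).symm
      rw [e]
      exact hseed.regularSolution_dt spec.sol hqsrc hqlax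
    · intro g nu hg hfg
      exact hseed.isEigen_dtFun (spec.eigen g nu hg fun i => hfg _) (hqg g nu hg hfg).1
    · intro g nu hg hfg
      obtain ⟨c, hc, hcg, hcc⟩ := spec.coeff g nu hg fun i => hfg _
      obtain ⟨hqg1, hqg2⟩ := hqg g nu hg hfg
      have hqg3 : ∀ x t, pair q (iterFun m f' g) x t
          = pair p g x t - ∑ k, pair p (f' k) x t * c k x t :=
        (hcc p _ hpe hpf (hfg _)).2
      -- the last coefficient of the new linear combination
      let s : ℝ → ℝ → 𝕜 := fun x t => pair q (iterFun m f' g) x t / tau q x t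
      have hs : ∀ x t, s x t * tau q x t = pair q (iterFun m f' g) x t := fun x t =>
        div_mul_cancel₀ _ (hτ0 x t)
      refine ⟨Fin.snoc (α := fun _ => ℝ → ℝ → 𝕜) (fun k x t => c k x t - s x t * d k x t) s,
        ?_, ?_, ?_⟩
      · intro i x t
        rw [Fin.sum_univ_castSucc]
        simp only [Fin.snoc_castSucc, Fin.snoc_last]
        refine Fin.lastCases ?_ (fun i => ?_) i
        · rw [Fin.snoc_last (α := fun _ => ℝ → ℝ → 𝕜)]
          have h1 := hs x t
          rw [hqg3, hτ, hpp.2] at h1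
          simp only [mul_sub, Finset.sum_sub_distrib, mul_left_comm _ (s x t), ← Finset.mul_sum]
          simp only [hf', hp] at h1 ⊢
          linear_combination h1
        · rw [Fin.snoc_castSucc (α := fun _ => ℝ → ℝ → 𝕜)]
          have h1 := hc i x t
          have h2 := hd i x t
          simp only [mul_sub, Finset.sum_sub_distrib, mul_left_comm _ (s x t), ← Finset.mul_sum]
          simp only [hf', hp] at h1 h2 ⊢
          linear_combination h1 - s x t * h2
      · intro x t
        change iterFun m f' g x t - q x t / tau q x t * pair q (iterFun m f' g) x t = _
        rw [Fin.sum_univ_castSucc]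
        simp only [Fin.snoc_castSucc, Fin.snoc_last, mul_sub, Finset.sum_sub_distrib,
          mul_left_comm _ (s x t), ← Finset.mul_sum]
        have h1 := hdp x t
        rw [hcg, show q x t / tau q x t * pair q (iterFun m f' g) x t = q x t * s x t by
          simp only [s]; ring]
        simp only [hf', hp] at h1 ⊢
        linear_combination (-s x t) * h1
      · intro h nu' hh hfh hhg
        obtain ⟨hqh1, hqh2⟩ := hqg h nu' hh hfh
        obtain ⟨hhg1, hhg2⟩ := hcc h nu' hh (fun i => hfh _) hhg
        obtain ⟨k1, k2⟩ := hseed.productDecays_dtFun (spec.eigen h nu' hh fun i => hfh _)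
          (spec.eigen g nu hg fun i => hfg _) hqh1 hqg1 hhg1
        refine ⟨k1, fun x t => ?_⟩
        refine (k2 x t).trans ?_
        change pair (iterFun m f' h) (iterFun m f' g) x t - pair q (iterFun m f' h) x t / tau q x t
          * pair q (iterFun m f' g) x t = _
        rw [Fin.sum_univ_castSucc]
        simp only [Fin.snoc_castSucc, Fin.snoc_last, mul_sub, Finset.sum_sub_distrib,
          mul_left_comm _ (s x t), ← Finset.mul_sum]
        rw [hhg2, show pair q (iterFun m f' h) x t / tau q x t * pair q (iterFun m f' g) x t
          = pair q (iterFun m f' h) x t * s x t by simp only [s]; ring, hqh2, pair_comm p h]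
        simp only [hf', hp]
        ring
    · intro g nu hg hfg hφg hgl
      exact hseed.solvesLax_dt spec.sol hqsrc hqlax (spec.eigen g nu hg fun i => hfg _)
        (hqg g nu hg hfg).1 (hsrc g nu hg hfg hφg)
        (spec.lax g nu hg (fun i => hfg _) hφg hgl)
    · intro j
      have h1 : iterSrc φ (m + 1) f (Fin.castAdd (m + 1) j)
          = dtFun q (iterSrc φ m f' (Fin.castAdd m j)) :=
        Fin.snoc_castSucc (α := fun _ => ℝ → ℝ → 𝕜) _ _ (Fin.castAdd m j)
      rw [h1, spec.src]
      rfl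
    · intro j
      refine Fin.lastCases ?_ (fun j => ?_) j
      · have h1 : iterSrc φ (m + 1) f (Fin.natAdd N (Fin.last m)) = dtNew q :=
          Fin.snoc_last (α := fun _ => ℝ → ℝ → 𝕜) _ _
        rw [h1, hseed.dtNew_eq_dtFun]
        rfl
      · have h1 : iterSrc φ (m + 1) f (Fin.natAdd N j.castSucc)
            = dtFun q (iterSrc φ m f' (Fin.natAdd N j)) :=
          Fin.snoc_castSucc (α := fun _ => ℝ → ℝ → 𝕜) _ _ (Fin.natAdd N j)
        rw [h1, spec.new]
        rfl
    · rw [hW1']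
      exact (RegFun 𝕜).mul_mem spec.W1_mem hτmem
    · intro x t
      change iterPot m f' u x t + 2 * dxxLog (tau q) x t = _
      rw [spec.pot, hW1', dxxLog_mul spec.W1_mem hτmem hWf' hτ0]
      ring

end Iteration
end KdVSources
end

open KdVSources in
theorem theorem5p1 {𝕜 : Type*} [RCLike 𝕜] (n N m : ℕ) (α : 𝕜)
    (lam : Fin N → 𝕜) (mu : Fin m → 𝕜) (nu : 𝕜)
    (u : ℝ → ℝ → 𝕜) (φ : Fin N → ℝ → ℝ → 𝕜) (f : Fin m → ℝ → ℝ → 𝕜) (ψ : ℝ → ℝ → 𝕜)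
    (hu : JointlySmooth u) (hφ : ∀ j, JointlySmooth (φ j))
    (hf : ∀ i, JointlySmooth (f i)) (hψ : JointlySmooth ψ)
    (hub : BoundedAtBot u)
    (hφf : ∀ j i, ProductDecays (φ j) (f i)) (hφψ : ∀ j, ProductDecays (φ j) ψ)
    (hff : ∀ i k, ProductDecays (f i) (f k)) (hfψ : ∀ i, ProductDecays (f i) ψ)
    (hsol : SolvesKdV n α lam u φ)
    (hfLax : ∀ i, SolvesLax n α (-(1 / 2) * α) u φ (mu i) (f i))
    (hψLax : SolvesLax n α (-(1 / 2) * α) u φ nu ψ)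
    (hreg : (∀ i x t, RCLike.im (f i x t) = 0) ∨
      ∀ (i : ℕ) (hi : i ≤ m) (x t : ℝ), W1 (fun k : Fin i => f (Fin.castLE hi k)) x t ≠ 0) :
    (∀ x t, W1 f x t ≠ 0) ∧
    (∀ x t, iterFun m f ψ x t = W2 (appendLast f ψ) x t / W1 f x t) ∧
    (∀ x t, iterPot m f u x t = u x t + 2 * dxxLog (W1 f) x t) ∧
    (∀ (j : Fin N) (x t : ℝ), iterSrc φ m f (Fin.castAdd m j) x t
      = W2 (appendLast f (φ j)) x t / W1 f x t) ∧
    (∀ (j : Fin m) (x t : ℝ),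
      iterSrc φ m f (Fin.natAdd N j) x t = W2 (appendLast f (f j)) x t / W1 f x t ∧
      W2 (appendLast f (f j)) x t / W1 f x t = W2 (moveLast f j) x t / W1 f x t) ∧
    SolvesLax n α (-(1 / 2) * α) (iterPot m f u) (iterSrc φ m f) nu (iterFun m f ψ) ∧
    SolvesKdV n α (Fin.append lam mu) (iterPot m f u) (iterSrc φ m f) := by
  have hprefix : ∀ (i : ℕ) (hi : i ≤ m) (x t : ℝ),
      W1 (fun k : Fin i => f (Fin.castLE hi k)) x t ≠ 0 := by
    rcases hreg with h | h
    · exact fun i hi x t => W1_ne_zero_of_real (fun k => (hf _).mem_regFun) (fun k l => hff _ _)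
        (fun k => h _) x t
    · exact h
  have hW : ∀ x t, W1 f x t ≠ 0 := fun x t => hprefix m le_rfl x t
  have hr : RegularSolution n α lam u φ := ⟨hu.mem_regFun, hub, fun j => (hφ j).mem_regFun, hsol⟩
  have hfe : ∀ i, IsEigen u (mu i) (f i) := fun i => ⟨(hf i).mem_regFun, (hfLax i).spatial⟩
  have hψe : IsEigen u nu ψ := ⟨hψ.mem_regFun, hψLax.spatial⟩
  have spec := iterSpec hr m f mu hfe hφf hff hfLax hprefix
  have hfun : ∀ g κ, IsEigen u κ g → (∀ i, ProductDecays (f i) g) → ∀ x t,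
      iterFun m f g x t = W2 (appendLast f g) x t / W1 f x t := by
    intro g κ hg hfg x t
    obtain ⟨c, hc, hcg, -⟩ := spec.coeff g κ hg hfg
    rw [hcg, W2_appendLast hc, mul_div_cancel_left₀ _ (hW x t)]
  refine ⟨hW, hfun ψ nu hψe hfψ, spec.pot, fun j x t => ?_, fun j x t => ⟨?_, ?_⟩,
    spec.lax ψ nu hψe hfψ hφψ hψLax, spec.sol.kdv⟩
  · rw [spec.src]
    exact hfun _ _ (hr.isEigen j) (fun i => (hφf j i).symm) x t
  · rw [spec.new]
    exact hfun _ _ (hfe j) (fun i => hff i j) x t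
  · obtain ⟨c, hc, -⟩ := spec.coeff (f j) _ (hfe j) fun i => hff i j
    rw [W2_appendLast hc, W2_moveLast j hc]
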